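/- Let $M$ be an inverse monoid with an inverse monoid presentation $\mathcal P=[X:\mathcal R]$, where $\mathcal R\subseteq A^*\times A^*$ and $A=X\sqcup X^{-1}$: there is a surjective homomorphism $\theta:\mathrm{FIM}(X)\to M$ whose induced congruence is generated by the images of the pairs in $\mathcal R$. Maps are written on the right, $\rho:A^*\to \mathrm{FIM}(X)$ is the natural map, $\geq$ is the natural partial order, and $w\mapsto w^{-1}$ is formal inversion of words in $A^*$. Let $\theta_{\min}$ be the congruence on $\mathrm{FIM}(X)$ in which $a,b$ are related iff there is an idempotent $f$ with $af=bf$ and $(a^{-1}a)\theta=f\theta=(b^{-1}b)\theta$; put $\mathcal T=\mathrm{FIM}(X)/\theta_{\min}$, with induced maps $\tau:\mathrm{FIM}(X)\to\mathcal T$ and $\psi:\mathcal T\to M$, so $\theta=\tau\psi$. The map $\psi$ restricts to a bijection $E(\mathcal T)\to E(M)$ of idempotents, by which these sets are identified. The Squier complex $\mathrm{Sq}(\mathcal P)$ has vertex set $\mathcal T$, an edge $(p,l,r,q)$ from $p(l\rho\tau)q$ to $p(r\rho\tau)q$ for all $p,q\in\mathcal T$, $(l,r)\in\mathcal R$, and,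 for all $p,q,p',q'\in\mathcal T$ and $(l,r),(l',r')\in\mathcal R$, a $2$-cell making the edge paths $(p,l,r,qp'(l'\rho\tau)q')\circ(p(r\rho\tau)qp',l',r',q')$ and $(p(l\rho\tau)qp',l',r',q')\circ(p,l,r,qp'(r'\rho\tau)q')$ homotopic. Its fundamental groupoid on the vertex set $\mathcal T$, with domain and range maps $\mathbf d,\mathbf r$, carries the left and right actions of $\mathcal T$ induced by $s\rhd(p,l,r,q)\lhd t=(sp,l,r,qt)$, and the operation $\alpha*\beta=(\alpha\lhd\beta\mathbf d)\circ(\alpha\mathbf r\rhd\beta)$. For $e\in E(\mathcal T)$ the set $\mathrm{star}_e^{\bowtie}=\{e\rhd\alpha\lhd e:\alpha\mathbf d=e\}$ is a group under $*$. Let $S^{\bowtie}=\bigsqcup_e\mathrm{star}_e^{\bowtie}$ and $(S^{\bowtie})^{ab}=\bigsqcup_e(\mathrm{star}_e^{\bowtie})^{ab}$, and write $\overline\alpha$ for the class of $\alpha$ in the abelianisation. A Lausch $M$-module is a presheaf of abelian groups $(A_e)_{e\in E(M)}$ with restriction maps $\alpha^e_f:A_e\to A_f$ for $e\ge f$ and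 an action $(a,s)\mapsto a\lhd s$ of $M$ on $\bigsqcup_e A_e$ such that, with $a\oplus b=a\alpha^e_{ef}+b\alpha^f_{ef}$ for $a\in A_e$, $b\in A_f$, one has $(a\oplus b)\lhd s=(a\lhd s)\oplus(b\lhd s)$, $a\lhd st=(a\lhd s)\lhd t$, $a\lhd e=a\oplus 0_e$ and $0_e\lhd s=0_{s^{-1}es}$ for all $s,t\in M$, $e\in E(M)$. The free Lausch $M$-module on a family of sets $(B_e)_{e\in E(M)}$ has as component at $e$ the free abelian group on $\{(b,s): b\in B_f,\ s\in M,\ f\ge ss^{-1},\ s^{-1}s=e\}$, with restriction maps $(b,s)\mapsto(b,se')$ for $e'\le e$ and action $(b,s)\lhd t=(b,st)$. Then there is a Lausch $M$-module structure on the family of abelian groups $(\mathrm{star}_e^{\bowtie})^{ab}$ in which $$\overline\alpha\lhd(w\psi)=\overline{w^{-1}\rhd\alpha\lhd w}\qquad(\alpha\in\mathrm{star}_e^{\bowtie},\ w\in\mathcal T),$$ and with this structure $(S^{\bowtie})^{ab}$ is isomorphic to the free Lausch $M$-module on the family $\mathcal Z$ with $$Z_e=\{(l,r)\in\mathcal R:(l^{-1}r)\rho\tau\psi=e\psi\},$$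 by an isomorphism that sends $((l,r),m)$ to $\overline{(u^{-1}(l^{-1}\rho\tau),l,r,u)}$ for every $u\in\mathcal T$ with $u\psi=m$. For each $e\in E(M)$, the component of $(S^{\bowtie})^{ab}$ at $e$ is the free abelian group on the set of triples $$Y_e=\{(l,r,m):(l,r)\in\mathcal R,\ m\in M,\ (l^{-1}r)\rho\tau\psi\ge mm^{-1},\ m^{-1}m=e\},$$ the triple $(l,r,m)$ corresponding to $\overline{(u^{-1}(l^{-1}\rho\tau),l,r,u)}$ for every $u\in\mathcal T$ with $u\psi=m$. -/

import Mathlib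

/-- An inverse monoid: every `a` has exactly one `b` with `a * b * a = a` and `b * a * b = b`, and
that element is `a⁻¹`. -/
class InverseMonoid (S : Type*) extends Monoid S, Inv S where
  mul_inv_mul : ∀ a : S, a * a⁻¹ * a = a
  inv_mul_inv : ∀ a : S, a⁻¹ * a * a⁻¹ = a⁻¹
  inv_unique : ∀ a b : S, a * b * a = a → b * a * b = b → b = a⁻¹

namespace InverseMonoid

section Basic

variable {S : Type*} [InverseMonoid S]

theorem inv_eq_of (a b : S) (h₁ : a * b * a = a) (h₂ : b * a * b = b) : a⁻¹ = b :=
  (inv_unique a b h₁ h₂).symm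

theorem mul_mul_cancel (a b : S) : a * (a⁻¹ * (a * b)) = a * b := by
  rw [← mul_assoc, ← mul_assoc, mul_inv_mul]

theorem inv_mul_cancel' (a b : S) : a⁻¹ * (a * (a⁻¹ * b)) = a⁻¹ * b := by
  rw [← mul_assoc, ← mul_assoc, inv_mul_inv]

theorem inv_inv' (a : S) : a⁻¹⁻¹ = a :=
  inv_eq_of _ _ (inv_mul_inv a) (mul_inv_mul a)

theorem inv_of_idem {e : S} (he : e * e = e) : e⁻¹ = e :=
  inv_eq_of _ _ (by rw [he, he]) (by rw [he, he])

theorem idem_mul {e f : S} (he : e * e = e) (hf : f * f = f) : (e * f) * (e * f) = e * f := by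
  have he' : ∀ z, e * (e * z) = e * z := fun z => by rw [← mul_assoc, he]
  have hf' : ∀ z, f * (f * z) = f * z := fun z => by rw [← mul_assoc, hf]
  set x := (e * f)⁻¹ with hx
  have h1 : e * f * x * (e * f) = e * f := mul_inv_mul _
  have h2 : x * (e * f) * x = x := inv_mul_inv _
  have h3 : f * x * e = x := by
    apply inv_unique
    · simp only [mul_assoc, he', hf'] at h1 ⊢
      exact h1
    · simp only [mul_assoc, he', hf'] at h2 ⊢
      have := congrArg (fun z => f * (z * e)) h2
      simpa only [mul_assoc] using this
  have h4 : x * x = x := by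
    have : f * (x * (e * f) * x) * e = f * x * e := by rw [h2]
    calc x * x = (f * x * e) * (f * x * e) := by rw [h3]
      _ = f * (x * (e * f) * x) * e := by simp only [mul_assoc]
      _ = x := by rw [this, h3]
  have h5 : e * f = x := by
    rw [← inv_inv' (e * f), ← hx, inv_of_idem h4]
  rw [h5, h4]

theorem idem_comm {e f : S} (he : e * e = e) (hf : f * f = f) : e * f = f * e := by
  have he' : ∀ z, e * (e * z) = e * z := fun z => by rw [← mul_assoc, he]
  have hf' : ∀ z, f * (f * z) = f * z := fun z => by rw [← mul_assoc, hf]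
  have h1 := idem_mul he hf
  have h2 := idem_mul hf he
  have h3 : (e * f)⁻¹ = f * e := by
    apply inv_eq_of
    · simp only [mul_assoc, he', hf'] at h1 ⊢
      exact h1
    · simp only [mul_assoc, he', hf'] at h2 ⊢
      exact h2
  rw [← h3, inv_of_idem h1]

theorem idem_mul_inv (a : S) : (a * a⁻¹) * (a * a⁻¹) = a * a⁻¹ := by
  rw [← mul_assoc, mul_inv_mul]

theorem idem_inv_mul (a : S) : (a⁻¹ * a) * (a⁻¹ * a) = a⁻¹ * a := by
  rw [← mul_assoc, inv_mul_inv]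

theorem mul_inv_rev' (a b : S) : (a * b)⁻¹ = b⁻¹ * a⁻¹ := by
  have h := idem_comm (idem_mul_inv b) (idem_inv_mul a)
  apply inv_eq_of
  · calc a * b * (b⁻¹ * a⁻¹) * (a * b) = a * ((b * b⁻¹) * (a⁻¹ * a)) * b := by
          simp only [mul_assoc]
      _ = (a * a⁻¹ * a) * (b * b⁻¹ * b) := by rw [h]; simp only [mul_assoc]
      _ = a * b := by rw [mul_inv_mul, mul_inv_mul]
  · calc b⁻¹ * a⁻¹ * (a * b) * (b⁻¹ * a⁻¹) = b⁻¹ * ((a⁻¹ * a) * (b * b⁻¹)) * a⁻¹ := by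
          simp only [mul_assoc]
      _ = (b⁻¹ * b * b⁻¹) * (a⁻¹ * a * a⁻¹) := by rw [← h]; simp only [mul_assoc]
      _ = b⁻¹ * a⁻¹ := by rw [inv_mul_inv, inv_mul_inv]

theorem idem_conj {e : S} (he : e * e = e) (s : S) :
    (s⁻¹ * e * s) * (s⁻¹ * e * s) = s⁻¹ * e * s := by
  calc (s⁻¹ * e * s) * (s⁻¹ * e * s) = s⁻¹ * (e * (s * s⁻¹)) * (e * s) := by
        simp only [mul_assoc]
    _ = (s⁻¹ * s * s⁻¹) * (e * e) * s := by
        rw [idem_comm he (idem_mul_inv s)]; simp only [mul_assoc]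
    _ = s⁻¹ * e * s := by rw [inv_mul_inv, he]

theorem map_inv' {N : Type*} [InverseMonoid N] (f : S →* N) (a : S) : f a⁻¹ = (f a)⁻¹ :=
  (inv_eq_of _ _ (by rw [← map_mul, ← map_mul, mul_inv_mul])
    (by rw [← map_mul, ← map_mul, inv_mul_inv])).symm

end Basic

/-- A monoid with an involution satisfying the usual identities is an inverse monoid. -/
abbrev ofInvolution {S : Type*} [Monoid S] (i : S → S) (hi : ∀ a, i (i a) = a)
    (hm : ∀ a b, i (a * b) = i b * i a) (h₁ : ∀ a, a * i a * a = a)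
    (hc : ∀ a b, a * i a * (b * i b) = b * i b * (a * i a)) : InverseMonoid S where
  inv := i
  mul_inv_mul := h₁
  inv_mul_inv a := by
    have := h₁ (i a)
    rwa [hi] at this
  inv_unique := by
    have h₂ : ∀ a, i a * a * i a = i a := fun a => by
      have := h₁ (i a)
      rwa [hi] at this
    have hself : ∀ e : S, e * e = e → e * i e = e := by
      intro e he
      have hie : i e * i e = i e := by rw [← hm, he]
      have hie' : i e = e := by
        have h3 := hc e (i e)
        rw [hi] at h3
        calc i e = i e * e * (e * i e) := by
              rw [mul_assoc, ← mul_assoc e e, he, ← mul_assoc, h₂]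
          _ = e * (i e * i e) * e := by rw [← h3]; simp only [mul_assoc]
          _ = e := by rw [hie, h₁]
      rw [hie', he]
    have hcomm : ∀ e f : S, e * e = e → f * f = f → e * f = f * e := by
      intro e f he hf
      have := hc e f
      rwa [hself e he, hself f hf] at this
    intro a b hab hba
    have e1 : (a * b) * (a * b) = a * b := by rw [← mul_assoc, hab]
    have e2 : (b * a) * (b * a) = b * a := by rw [← mul_assoc, hba]
    have e3 : (a * i a) * (a * i a) = a * i a := by rw [← mul_assoc, h₁]
    have e4 : (i a * a) * (i a * a) = i a * a := by rw [← mul_assoc, h₂]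
    calc b = b * a * b := hba.symm
      _ = b * (a * i a * a) * b := by rw [h₁]
      _ = b * ((a * i a) * (a * b)) := by simp only [mul_assoc]
      _ = (b * a * b) * (a * i a) := by rw [hcomm _ _ e3 e1]; simp only [mul_assoc]
      _ = (b * a) * ((i a * a) * i a) := by rw [hba, h₂]; simp only [mul_assoc]
      _ = ((i a * a) * (b * a)) * i a := by rw [hcomm _ _ e4 e2]; simp only [mul_assoc]
      _ = i a * (a * b * a) * i a := by simp only [mul_assoc]
      _ = i a := by rw [hab, h₂]

/-- The natural partial order of an inverse monoid. -/
def NatLE {S : Type*} [InverseMonoid S] (a b : S) : Prop := ∃ e : S, e * e = e ∧ a = b * e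

/-- The idempotents of an inverse monoid. -/
@[ext] structure Idem (S : Type*) [InverseMonoid S] where
  val : S
  idem : val * val = val

namespace Idem

variable {S : Type*} [InverseMonoid S]

/-- The meet `e f` of two idempotents. -/
def mul (e f : Idem S) : Idem S := ⟨e.val * f.val, idem_mul e.idem f.idem⟩

/-- The idempotent `s⁻¹ e s`. -/
def conj (e : Idem S) (s : S) : Idem S := ⟨s⁻¹ * e.val * s, idem_conj e.idem s⟩

theorem mul_le_left (e f : Idem S) : NatLE (e.mul f).1 e.val := ⟨f.val, f.idem, rfl⟩

theorem mul_le_right (e f : Idem S) : NatLE (e.mul f).1 f.val :=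
  ⟨e.val, e.idem, idem_comm e.idem f.idem⟩

theorem le_refl (e : Idem S) : NatLE e.val e.val := ⟨e.val, e.idem, e.idem.symm⟩

theorem mul_of_le {e f : Idem S} (h : NatLE f.val e.val) : e.val * f.val = f.val := by
  obtain ⟨g, -, hg⟩ := h
  rw [hg, ← mul_assoc, e.idem]

theorem le_trans {e f g : Idem S} (h : NatLE f.val e.val) (h' : NatLE g.val f.val) : NatLE g.val e.val :=
  ⟨g.val, g.idem, by rw [← mul_of_le h', ← mul_assoc, mul_of_le h]⟩

end Idem

/-- A presheaf of abelian groups `A e` over the semilattice `E(S)`, that is, a Clifford semigroup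
of abelian groups. -/
structure LauschPresheaf (S : Type*) [InverseMonoid S] (A : Idem S → Type*)
    [∀ e, AddCommGroup (A e)] where
  /-- the restriction maps -/
  res : ∀ {e f : Idem S}, NatLE f.val e.val → A e →+ A f
  res_refl : ∀ (e : Idem S) (a : A e), res (Idem.le_refl e) a = a
  res_trans : ∀ {e f g : Idem S} (h : NatLE f.val e.val) (h' : NatLE g.val f.val) (a : A e),
    res h' (res h a) = res (Idem.le_trans h h') a

/-- The operation `a ⊕ b` on the disjoint union of the groups of a presheaf: the sum in
`A (e f)` of the restrictions of `a ∈ A e` and `b ∈ A f`. -/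
def LauschPresheaf.oplus {S : Type*} [InverseMonoid S] {A : Idem S → Type*}
    [∀ e, AddCommGroup (A e)] (P : LauschPresheaf S A) (a b : Σ e, A e) : Σ e, A e :=
  ⟨a.1.mul b.1, P.res (Idem.mul_le_left a.1 b.1) a.2 + P.res (Idem.mul_le_right a.1 b.1) b.2⟩

/-- A Lausch module over `S` with underlying family `A e`, `e ∈ E(S)`, of abelian groups: a presheaf
on this family and an action of `S` on the disjoint union `⊔ A e`. -/
structure LauschModule (S : Type*) [InverseMonoid S] (A : Idem S → Type*)
    [∀ e, AddCommGroup (A e)] extends LauschPresheaf S A where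
  /-- the action of `S` on the disjoint union of the groups -/
  act : (Σ e, A e) → S → Σ e, A e
  oplus_act : ∀ (a b : Σ e, A e) (s : S),
    act (toLauschPresheaf.oplus a b) s = toLauschPresheaf.oplus (act a s) (act b s)
  act_mul : ∀ (a : Σ e, A e) (s t : S), act a (s * t) = act (act a s) t
  act_idem : ∀ (a : Σ e, A e) (e : Idem S), act a e.val = toLauschPresheaf.oplus a ⟨e, 0⟩
  zero_act : ∀ (e : Idem S) (s : S), act ⟨e, 0⟩ s = ⟨e.conj s, 0⟩

/-- An isomorphism of Lausch modules: isomorphisms of the groups at each idempotent that are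
compatible with restriction and with the action. -/
structure LauschIso {S : Type*} [InverseMonoid S] {A B : Idem S → Type*}
    [∀ e, AddCommGroup (A e)] [∀ e, AddCommGroup (B e)]
    (L : LauschModule S A) (N : LauschModule S B) where
  /-- the isomorphism at `e` -/
  equiv : ∀ e, A e ≃+ B e
  map_res : ∀ {e f : Idem S} (h : NatLE f.val e.val) (a : A e),
    equiv f (L.res h a) = N.res h (equiv e a)
  map_act : ∀ (e : Idem S) (a : A e) (s : S),
    (⟨(L.act ⟨e, a⟩ s).1, equiv _ (L.act ⟨e, a⟩ s).2⟩ : Σ e, B e) = N.act ⟨e, equiv e a⟩ s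

section Free

variable {S : Type*} [InverseMonoid S] (B : Idem S → Type*)

/-- The basis at `e` of the free Lausch module on the family of sets `B`: the pairs `(b, s)` with
`b ∈ B f`, `f ≥ s s⁻¹` and `s⁻¹ s = e`. -/
@[ext] structure FreeIndex (e : Idem S) where
  base : Σ f, B f
  elt : S
  le : NatLE (elt * elt⁻¹) base.1.val
  eq : elt⁻¹ * elt = e.val

variable {B}

/-- `(b, s) ↦ (b, s t)`, at any idempotent equal to `t⁻¹ e t`. -/
def FreeIndex.smul {e f : Idem S} (t : S) (h : t⁻¹ * e.val * t = f.val) (x : FreeIndex B e) :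
    FreeIndex B f where
  base := x.base
  elt := x.elt * t
  le := by
    obtain ⟨g, hg, hs⟩ := x.le
    refine ⟨g * ((x.elt * t) * (x.elt * t)⁻¹), idem_mul hg (idem_mul_inv _), ?_⟩
    rw [← mul_assoc, ← hs]
    simp only [mul_assoc, mul_mul_cancel]
  eq := by
    rw [← h, ← x.eq, mul_inv_rev']
    simp only [mul_assoc]

theorem FreeIndex.conj_of_le {e f : Idem S} (h : NatLE f.val e.val) : f.val⁻¹ * e.val * f.val = f.val := by
  rw [inv_of_idem f.idem, mul_assoc, Idem.mul_of_le h, f.idem]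

theorem FreeIndex.sigma_ext {e₁ e₂ f g : Idem S} (h : f = g)
    (k₁ : FreeIndex B e₁ → FreeIndex B f) (k₂ : FreeIndex B e₂ → FreeIndex B f)
    (j₁ : FreeIndex B e₁ → FreeIndex B g) (j₂ : FreeIndex B e₂ → FreeIndex B g)
    (h₁ : ∀ x, (k₁ x).base = (j₁ x).base ∧ (k₁ x).elt = (j₁ x).elt)
    (h₂ : ∀ x, (k₂ x).base = (j₂ x).base ∧ (k₂ x).elt = (j₂ x).elt)
    (a : FreeAbelianGroup (FreeIndex B e₁)) (b : FreeAbelianGroup (FreeIndex B e₂)) :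
    (⟨f, FreeAbelianGroup.map k₁ a + FreeAbelianGroup.map k₂ b⟩ :
        Σ e, FreeAbelianGroup (FreeIndex B e)) =
      ⟨g, FreeAbelianGroup.map j₁ a + FreeAbelianGroup.map j₂ b⟩ := by
  subst h
  rw [show k₁ = j₁ from funext fun x => FreeIndex.ext (h₁ x).1 (h₁ x).2,
    show k₂ = j₂ from funext fun x => FreeIndex.ext (h₂ x).1 (h₂ x).2]

theorem FreeIndex.sigma_ext_one {e₁ f g : Idem S} (h : f = g)
    (k₁ : FreeIndex B e₁ → FreeIndex B f) (j₁ : FreeIndex B e₁ → FreeIndex B g)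
    (h₁ : ∀ x, (k₁ x).base = (j₁ x).base ∧ (k₁ x).elt = (j₁ x).elt) (a : FreeAbelianGroup (FreeIndex B e₁)) :
    (⟨f, FreeAbelianGroup.map k₁ a⟩ : Σ e, FreeAbelianGroup (FreeIndex B e)) =
      ⟨g, FreeAbelianGroup.map j₁ a⟩ := by
  subst h
  rw [show k₁ = j₁ from funext fun x => FreeIndex.ext (h₁ x).1 (h₁ x).2]

theorem conj_mul' (e : Idem S) (s t : S) : e.conj (s * t) = (e.conj s).conj t :=
  Idem.ext (by simp only [Idem.conj, mul_inv_rev', mul_assoc])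

theorem conj_meet (e f : Idem S) (s : S) : (e.mul f).conj s = (e.conj s).mul (f.conj s) := by
  apply Idem.ext
  simp only [Idem.conj, Idem.mul]
  calc s⁻¹ * (e.val * f.val) * s = s⁻¹ * s * s⁻¹ * (e.val * f.val) * s := by rw [inv_mul_inv]
    _ = s⁻¹ * ((s * s⁻¹) * e.val) * f.val * s := by simp only [mul_assoc]
    _ = s⁻¹ * e.val * s * (s⁻¹ * f.val * s) := by
        rw [idem_comm (idem_mul_inv s) e.idem]; simp only [mul_assoc]

theorem conj_idem (e f : Idem S) : e.conj f.val = e.mul f := by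
  apply Idem.ext
  simp only [Idem.conj, Idem.mul]
  rw [inv_of_idem f.idem, idem_comm f.idem e.idem, mul_assoc, f.idem]

variable (B)

/-- The free Lausch module on the family of sets `B`: its group at `e` is the free abelian group on
the pairs `(b, s)` of `FreeIndex B e`, with restriction `(b, s) ↦ (b, s e')` and action
`(b, s) ◁ t = (b, s t)`. -/
def freeLausch : LauschModule S (fun e => FreeAbelianGroup (FreeIndex B e)) where
  res {_ f} h := FreeAbelianGroup.map (FreeIndex.smul f.val (FreeIndex.conj_of_le h))
  res_refl e a := by
    conv_rhs => rw [← FreeAbelianGroup.map_id_apply a]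
    congr 2
    funext x
    refine FreeIndex.ext rfl ?_
    change x.elt * e.val = x.elt
    rw [← x.eq, ← mul_assoc, mul_inv_mul]
  res_trans {e f g} h h' a := by
    rw [← FreeAbelianGroup.map_comp_apply]
    congr 2
    funext x
    refine FreeIndex.ext rfl ?_
    change x.elt * f.val * g.val = x.elt * g.val
    rw [mul_assoc, Idem.mul_of_le h']
  act a t := ⟨a.1.conj t, FreeAbelianGroup.map (FreeIndex.smul t rfl) a.2⟩
  oplus_act a b s := by
    obtain ⟨e, a⟩ := a
    obtain ⟨f, b⟩ := b
    simp only [LauschPresheaf.oplus]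
    refine (congrArg (Sigma.mk ((e.mul f).conj s))
      (map_add (FreeAbelianGroup.map (FreeIndex.smul s rfl)) _ _)).trans ?_
    simp only [← FreeAbelianGroup.map_comp_apply]
    refine FreeIndex.sigma_ext (conj_meet e f s) _ _ _ _ (fun x => ?_) (fun x => ?_) a b
    · refine ⟨rfl, ?_⟩
      change x.elt * (e.val * f.val) * s = x.elt * s * ((s⁻¹ * e.val * s) * (s⁻¹ * f.val * s))
      have h := congrArg Idem.val (conj_meet e f s)
      simp only [Idem.conj, Idem.mul] at h
      rw [← h]
      calc x.elt * (e.val * f.val) * s = x.elt * ((e.val * f.val) * (s * s⁻¹)) * s := by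
            simp only [mul_assoc]
            rw [← mul_assoc s s⁻¹ s, mul_inv_mul]
        _ = _ := by
            rw [idem_comm (idem_mul e.idem f.idem) (idem_mul_inv s)]; simp only [mul_assoc]
    · refine ⟨rfl, ?_⟩
      change x.elt * (e.val * f.val) * s = x.elt * s * ((s⁻¹ * e.val * s) * (s⁻¹ * f.val * s))
      have h := congrArg Idem.val (conj_meet e f s)
      simp only [Idem.conj, Idem.mul] at h
      rw [← h]
      calc x.elt * (e.val * f.val) * s = x.elt * ((e.val * f.val) * (s * s⁻¹)) * s := by
            simp only [mul_assoc]
            rw [← mul_assoc s s⁻¹ s, mul_inv_mul]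
        _ = _ := by
            rw [idem_comm (idem_mul e.idem f.idem) (idem_mul_inv s)]; simp only [mul_assoc]
  act_mul a s t := by
    obtain ⟨e, a⟩ := a
    simp only [← FreeAbelianGroup.map_comp_apply]
    refine FreeIndex.sigma_ext_one (conj_mul' e s t) _ _ (fun x => ?_) a
    exact ⟨rfl, (mul_assoc _ _ _).symm⟩
  act_idem a f := by
    obtain ⟨e, a⟩ := a
    simp only [LauschPresheaf.oplus, map_zero, add_zero]
    refine FreeIndex.sigma_ext_one (conj_idem e f) _ _ (fun x => ?_) a
    refine ⟨rfl, ?_⟩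
    change x.elt * f.val = x.elt * (e.val * f.val)
    rw [← x.eq, ← mul_assoc, ← mul_assoc, mul_inv_mul]
  zero_act e s := by simp only [map_zero]

end Free

end InverseMonoid

namespace InverseMonoid

section FreeInverseMonoid

/-- Words over the alphabet `A = X ⊔ X⁻¹`: `(x, true)` is the letter `x`, `(x, false)` is the
letter `x⁻¹`. -/
abbrev Word (X : Type*) : Type _ := FreeMonoid (X × Bool)

/-- The formal inverse of a word. -/
def Word.inv {X : Type*} (w : Word X) : Word X :=
  FreeMonoid.ofList ((FreeMonoid.toList w).map fun a => (a.1, !a.2)).reverse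

theorem Word.inv_inv {X : Type*} (w : Word X) : w.inv.inv = w := by
  apply FreeMonoid.toList.injective
  simp [Word.inv, List.map_reverse, Function.comp_def]

theorem Word.inv_mul {X : Type*} (v w : Word X) : (v * w).inv = w.inv * v.inv := by
  apply FreeMonoid.toList.injective
  simp [Word.inv, FreeMonoid.toList_mul]

/-- The generating pairs of the Wagner congruence. -/
inductive WagnerRel (X : Type*) : Word X → Word X → Prop
  | cancel (w : Word X) : WagnerRel X (w * w.inv * w) w
  | comm (v w : Word X) : WagnerRel X (v * v.inv * (w * w.inv)) (w * w.inv * (v * v.inv))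

/-- The Wagner congruence on the free monoid `A*`. -/
def wagnerCon (X : Type*) : Con (Word X) := conGen (WagnerRel X)

theorem wagnerCon_inv {X : Type*} {v w : Word X} (h : wagnerCon X v w) :
    wagnerCon X v.inv w.inv := by
  induction h with
  | of x y h =>
    cases h with
    | cancel =>
      have : wagnerCon X _ _ := ConGen.Rel.of _ _ (WagnerRel.cancel y.inv)
      simpa only [Word.inv_mul, Word.inv_inv, mul_assoc] using this
    | comm v w =>
      have : wagnerCon X _ _ := ConGen.Rel.of _ _ (WagnerRel.comm w v)
      simpa only [Word.inv_mul, Word.inv_inv, mul_assoc] using this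
  | refl x => exact (wagnerCon X).refl _
  | symm _ ih => exact (wagnerCon X).symm ih
  | trans _ _ ih₁ ih₂ => exact (wagnerCon X).trans ih₁ ih₂
  | mul _ _ ih₁ ih₂ =>
    rw [Word.inv_mul, Word.inv_mul]
    exact (wagnerCon X).mul ih₂ ih₁

/-- The free inverse monoid on `X`. -/
def FIM (X : Type*) : Type _ := (wagnerCon X).Quotient

instance (X : Type*) : Monoid (FIM X) := inferInstanceAs (Monoid (wagnerCon X).Quotient)

/-- The natural map `ρ : A* → FIM(X)`. -/
def FIM.rho (X : Type*) : Word X →* FIM X := (wagnerCon X).mk'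

theorem FIM.rho_surjective (X : Type*) : Function.Surjective (FIM.rho X) := Con.mk'_surjective

theorem FIM.rho_eq {X : Type*} {v w : Word X} (h : wagnerCon X v w) :
    FIM.rho X v = FIM.rho X w := (Con.eq _).2 h

/-- Inversion in the free inverse monoid is induced by formal inversion of words. -/
def FIM.inv {X : Type*} : FIM X → FIM X :=
  Quotient.map Word.inv fun _ _ h => wagnerCon_inv h

instance (X : Type*) : InverseMonoid (FIM X) :=
  ofInvolution FIM.inv
    (fun a => by
      obtain ⟨a, rfl⟩ := FIM.rho_surjective X a
      exact congrArg (FIM.rho X) (Word.inv_inv a))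
    (fun a b => by
      obtain ⟨a, rfl⟩ := FIM.rho_surjective X a
      obtain ⟨b, rfl⟩ := FIM.rho_surjective X b
      exact congrArg (FIM.rho X) (Word.inv_mul a b))
    (fun a => by
      obtain ⟨a, rfl⟩ := FIM.rho_surjective X a
      exact FIM.rho_eq (ConGen.Rel.of _ _ (WagnerRel.cancel a)))
    (fun a b => by
      obtain ⟨a, rfl⟩ := FIM.rho_surjective X a
      obtain ⟨b, rfl⟩ := FIM.rho_surjective X b
      exact FIM.rho_eq (ConGen.Rel.of _ _ (WagnerRel.comm a b)))

end FreeInverseMonoid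

section MinCon

variable {S N : Type*} [InverseMonoid S] [InverseMonoid N]

theorem idem_conj_comm {c f : S} (hf : f * f = f) {e : S} (he : e * e = e) :
    c * (f * (c⁻¹ * e * c)) = e * (c * f) := by
  rw [idem_comm hf (idem_conj he c)]
  calc c * (c⁻¹ * e * c * f) = (c * c⁻¹) * e * (c * f) := by simp only [mul_assoc]
    _ = e * (c * c⁻¹ * c * f) := by
        rw [idem_comm (idem_mul_inv c) he]; simp only [mul_assoc]
    _ = e * (c * f) := by rw [mul_inv_mul]

/-- The smallest congruence with the same trace as the congruence induced by `θ`: `a` and `b` are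
related if `a e = b e` for some idempotent `e` with the same image under `θ` as `a⁻¹ a` and
`b⁻¹ b`. -/
def minCon (θ : S →* N) : Con S where
  r a b := ∃ e : S, e * e = e ∧ a * e = b * e ∧ θ (a⁻¹ * a) = θ e ∧ θ e = θ (b⁻¹ * b)
  iseqv :=
    { refl a := ⟨a⁻¹ * a, idem_inv_mul a, rfl, rfl, rfl⟩
      symm := fun ⟨e, he, h, h₁, h₂⟩ => ⟨e, he, h.symm, h₂.symm, h₁.symm⟩
      trans := by
        rintro a b c ⟨e, he, h, h₁, h₂⟩ ⟨f, hf, h', h₁', h₂'⟩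
        have hef : θ e = θ f := h₂.trans h₁'
        have key : θ (e * f) = θ e := by rw [map_mul, ← hef, ← map_mul, he]
        refine ⟨e * f, idem_mul he hf, ?_, h₁.trans key.symm, ?_⟩
        · rw [← mul_assoc, h, mul_assoc, idem_comm he hf, ← mul_assoc, h', mul_assoc]
        · rw [key, hef, h₂'] }
  mul' := by
    rintro a b c d ⟨e, he, h, h₁, h₂⟩ ⟨f, hf, h', h₁', h₂'⟩
    have ht : ∀ {x y : S} {g : S}, x * g = y * g → θ (x⁻¹ * x) = θ g → θ g = θ (y⁻¹ * y) →
        θ x = θ y := by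
      intro x y g hg hx hy
      calc θ x = θ (x * (x⁻¹ * x)) := by rw [← mul_assoc, mul_inv_mul]
        _ = θ (x * g) := by rw [map_mul, hx, ← map_mul]
        _ = θ (y * (y⁻¹ * y)) := by rw [hg, map_mul, hy, ← map_mul]
        _ = θ y := by rw [← mul_assoc, mul_inv_mul]
    have hab := ht h h₁ h₂
    have hcd := ht h' h₁' h₂'
    have e1 : θ ((a * c)⁻¹ * (a * c)) = θ (f * (c⁻¹ * e * c)) := by
      have : (a * c)⁻¹ * (a * c) = c⁻¹ * (a⁻¹ * a) * c := by
        rw [mul_inv_rev']; simp only [mul_assoc]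
      rw [this]
      calc θ (c⁻¹ * (a⁻¹ * a) * c) = θ (c⁻¹ * e * c) := by
            rw [map_mul, map_mul, h₁, ← map_mul, ← map_mul]
        _ = θ (c⁻¹ * c * (c⁻¹ * e * c)) := by
            rw [← mul_assoc, ← mul_assoc, inv_mul_inv]
        _ = θ (f * (c⁻¹ * e * c)) := by rw [map_mul, h₁', ← map_mul]
    refine ⟨f * (c⁻¹ * e * c), idem_mul hf (idem_conj he c), ?_, e1, ?_⟩
    · rw [mul_assoc, idem_conj_comm hf he, ← mul_assoc, h]
      rw [mul_assoc b d, ← mul_assoc d, ← h', mul_assoc c, idem_conj_comm hf he, mul_assoc]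
    · rw [← e1]
      simp only [map_mul, map_inv', hab, hcd]

theorem map_eq_of_minCon {θ : S →* N} {a b : S} (h : minCon θ a b) : θ a = θ b := by
  obtain ⟨e, -, h, h₁, h₂⟩ := h
  calc θ a = θ (a * (a⁻¹ * a)) := by rw [← mul_assoc, mul_inv_mul]
    _ = θ (a * e) := by rw [map_mul, h₁, ← map_mul]
    _ = θ (b * (b⁻¹ * b)) := by rw [h, map_mul, h₂, ← map_mul]
    _ = θ b := by rw [← mul_assoc, mul_inv_mul]

theorem minCon_inv {θ : S →* N} {a b : S} (h : minCon θ a b) : minCon θ a⁻¹ b⁻¹ := by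
  have hab := map_eq_of_minCon h
  obtain ⟨e, he, h, h₁, h₂⟩ := h
  have key : ∀ x : S, x⁻¹ * (x * e * x⁻¹) = e * x⁻¹ := by
    intro x
    calc x⁻¹ * (x * e * x⁻¹) = (x⁻¹ * x) * e * x⁻¹ := by simp only [mul_assoc]
      _ = e * (x⁻¹ * x * x⁻¹) := by rw [idem_comm (idem_inv_mul x) he]; simp only [mul_assoc]
      _ = e * x⁻¹ := by rw [inv_mul_inv]
  have hinv : e * a⁻¹ = e * b⁻¹ := by
    have := congrArg (·⁻¹) h
    simpa only [mul_inv_rev', inv_of_idem he] using this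
  have hf : a * e * a⁻¹ = b * e * b⁻¹ := by
    rw [mul_assoc, hinv, ← mul_assoc, h]
  have hθ : θ (a⁻¹⁻¹ * a⁻¹) = θ (a * e * a⁻¹) := by
    rw [inv_inv', map_mul θ (a * e), map_mul θ a e, ← h₁, ← map_mul, ← map_mul, ← mul_assoc a,
      mul_inv_mul]
  refine ⟨a * e * a⁻¹, ?_, ?_, hθ, ?_⟩
  · have := idem_conj he a⁻¹
    rwa [inv_inv'] at this
  · rw [key]
    conv_rhs => rw [hf, key]
    exact hinv
  · rw [← hθ, inv_inv', inv_inv', map_mul, map_mul, map_inv', map_inv', hab]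

instance (θ : S →* N) : InverseMonoid (minCon θ).Quotient :=
  ofInvolution (Quotient.map (·⁻¹) fun _ _ h => minCon_inv h)
    (fun a => by
      obtain ⟨a, rfl⟩ := Con.mk'_surjective a
      exact congrArg (minCon θ).mk' (inv_inv' a))
    (fun a b => by
      obtain ⟨a, rfl⟩ := Con.mk'_surjective a
      obtain ⟨b, rfl⟩ := Con.mk'_surjective b
      exact congrArg (minCon θ).mk' (mul_inv_rev' a b))
    (fun a => by
      obtain ⟨a, rfl⟩ := Con.mk'_surjective a
      exact congrArg (minCon θ).mk' (mul_inv_mul a))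
    (fun a b => by
      obtain ⟨a, rfl⟩ := Con.mk'_surjective a
      obtain ⟨b, rfl⟩ := Con.mk'_surjective b
      exact congrArg (minCon θ).mk' (idem_comm (idem_mul_inv a) (idem_mul_inv b)))

end MinCon

/-- An inverse monoid presentation `[X : 𝓡]` of `M`: a set `rels` of pairs of words over
`X ⊔ X⁻¹` and a surjective presentation map `θ : FIM(X) → M` whose induced congruence is generated
by the pairs in `rels`. -/
structure Presentation (X : Type*) (M : Type*) [InverseMonoid M] where
  /-- the relations -/
  rels : Set (Word X × Word X)
  /-- the presentation map -/
  θ : FIM X →* M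
  surjective : Function.Surjective θ
  ker_eq : Con.ker θ = conGen fun a b => ∃ w ∈ rels, a = FIM.rho X w.1 ∧ b = FIM.rho X w.2

namespace Presentation

variable {X M : Type*} [InverseMonoid M] (P : Presentation X M)

/-- The inverse monoid `𝓣(M, X) = FIM(X) / θ_min`. -/
abbrev T : Type _ := (minCon P.θ).Quotient

/-- The map `τ : FIM(X) → 𝓣`. -/
def τ : FIM X →* P.T := (minCon P.θ).mk'

/-- The map `ψ : 𝓣 → M`. -/
def ψ : P.T →* M := (minCon P.θ).lift P.θ fun _ _ h => map_eq_of_minCon h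

/-- The map `ρτ : A* → 𝓣`. -/
def ρτ : Word X →* P.T := P.τ.comp (FIM.rho X)

theorem ψ_τ (a : FIM X) : P.ψ (P.τ a) = P.θ a := rfl

theorem τ_surjective : Function.Surjective P.τ := Con.mk'_surjective

theorem ψ_rel {w : Word X × Word X} (h : w ∈ P.rels) : P.ψ (P.ρτ w.1) = P.ψ (P.ρτ w.2) := by
  have h' : Con.ker P.θ (FIM.rho X w.1) (FIM.rho X w.2) := by
    rw [P.ker_eq]
    exact ConGen.Rel.of _ _ ⟨w, h, rfl, rfl⟩
  exact h'

/-- `ψ` is idempotent separating. -/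
theorem idem_eq {e f : P.T} (he : e * e = e) (hf : f * f = f) (h : P.ψ e = P.ψ f) : e = f := by
  obtain ⟨a, rfl⟩ := P.τ_surjective e
  obtain ⟨b, rfl⟩ := P.τ_surjective f
  have ha : P.τ a = P.τ (a * a⁻¹) := by
    rw [map_mul, map_inv', inv_of_idem he, he]
  have hb : P.τ b = P.τ (b * b⁻¹) := by
    rw [map_mul, map_inv', inv_of_idem hf, hf]
  rw [ha, hb, ψ_τ, ψ_τ] at h
  rw [ha, hb]
  have hi := idem_mul_inv a
  have hj := idem_mul_inv b
  refine (Con.eq _).2 ⟨a * a⁻¹ * (b * b⁻¹), idem_mul hi hj, ?_, ?_, ?_⟩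
  · rw [← mul_assoc (a * a⁻¹), hi, idem_comm hi hj, ← mul_assoc (b * b⁻¹) (b * b⁻¹), hj]
  · rw [inv_of_idem hi, hi, map_mul P.θ (a * a⁻¹), ← h, ← map_mul, hi]
  · rw [inv_of_idem hj, hj, map_mul P.θ (a * a⁻¹), h, ← map_mul, hj]

theorem exists_idem (e : Idem M) : ∃ f : Idem P.T, P.ψ f.val = e.val := by
  obtain ⟨a, ha⟩ := P.surjective e.val
  refine ⟨⟨P.τ a * (P.τ a)⁻¹, idem_mul_inv _⟩, ?_⟩
  change P.ψ (P.τ a * (P.τ a)⁻¹) = e.val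
  rw [map_mul, map_inv', ψ_τ, ha, inv_of_idem e.idem, e.idem]

/-- The unique idempotent of `𝓣` with image `e` under `ψ`. -/
noncomputable def lift (e : Idem M) : Idem P.T := (P.exists_idem e).choose

theorem ψ_lift (e : Idem M) : P.ψ (P.lift e).val = e.val := (P.exists_idem e).choose_spec

/-- An edge `(p, l, r, q)` of the Squier complex. -/
@[ext] structure Edge where
  p : P.T
  l : Word X
  r : Word X
  q : P.T
  rel : (l, r) ∈ P.rels

namespace Edge

variable {P}

/-- The start `p (l ρτ) q` of an edge. -/
def src (a : P.Edge) : P.T := a.p * P.ρτ a.l * a.q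

/-- The end `p (r ρτ) q` of an edge. -/
def tgt (a : P.Edge) : P.T := a.p * P.ρτ a.r * a.q

/-- `s ▷ (p, l, r, q) ◁ t = (s p, l, r, q t)`. -/
def whisker (s : P.T) (a : P.Edge) (t : P.T) : P.Edge := ⟨s * a.p, a.l, a.r, a.q * t, a.rel⟩

end Edge

/-- An edge together with a direction: `(a, true)` runs along `a`, `(a, false)` against it. -/
abbrev Step : Type _ := P.Edge × Bool

namespace Step

variable {P}

def src (s : P.Step) : P.T := if s.2 then s.1.src else s.1.tgt

def tgt (s : P.Step) : P.T := if s.2 then s.1.tgt else s.1.src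

def rev (s : P.Step) : P.Step := (s.1, !s.2)

def whisker (x : P.T) (s : P.Step) (y : P.T) : P.Step := (s.1.whisker x y, s.2)

end Step

/-- `IsPath a L b`: the list `L` of steps is an edge path from `a` to `b`. -/
def IsPath (a : P.T) : List P.Step → P.T → Prop
  | [], b => a = b
  | s :: L, b => s.src = a ∧ IsPath s.tgt L b

/-- An edge path in the Squier complex. -/
@[ext] structure EdgePath where
  src : P.T
  tgt : P.T
  steps : List P.Step
  isPath : P.IsPath src steps tgt

/-- The two edge paths of length two around the `2`-cell given by `p`, `(l, r)`, `q`, `p'`,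
`(l', r')`, `q'`. -/
inductive Cell : List P.Step → List P.Step → Prop
  | mk (p : P.T) (l r : Word X) (h : (l, r) ∈ P.rels) (q p' : P.T) (l' r' : Word X)
      (h' : (l', r') ∈ P.rels) (q' : P.T) :
      Cell
        [(⟨p, l, r, q * p' * P.ρτ l' * q', h⟩, true),
          (⟨p * P.ρτ r * q * p', l', r', q', h'⟩, true)]
        [(⟨p * P.ρτ l * q * p', l', r', q', h'⟩, true),
          (⟨p, l, r, q * p' * P.ρτ r' * q', h⟩, true)]

variable {P}

/-- An elementary homotopy: deletion of a subpath consisting of a step and its reverse, or replacement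
of one side of a `2`-cell by the other. -/
inductive ElemHomotopy (α β : P.EdgePath) : Prop
  | cancel (h₁ : α.src = β.src) (h₂ : α.tgt = β.tgt) (L L' : List P.Step) (s : P.Step)
      (hα : α.steps = L ++ [s, s.rev] ++ L') (hβ : β.steps = L ++ L') : ElemHomotopy α β
  | cell (h₁ : α.src = β.src) (h₂ : α.tgt = β.tgt) (L L' C D : List P.Step) (h : P.Cell C D)
      (hα : α.steps = L ++ C ++ L') (hβ : β.steps = L ++ D ++ L') : ElemHomotopy α β

/-- Homotopy of edge paths relative to their end points. -/
instance homotopySetoid (P : Presentation X M) : Setoid P.EdgePath :=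
  Relation.EqvGen.setoid ElemHomotopy

/-- The fundamental groupoid of the Squier complex on its vertex set, as the set of all its arrows,
the homotopy classes of edge paths. -/
def Arrow (P : Presentation X M) : Type _ := Quotient P.homotopySetoid

theorem IsPath.append {a b c : P.T} {L L' : List P.Step} (h : P.IsPath a L b)
    (h' : P.IsPath b L' c) : P.IsPath a (L ++ L') c := by
  induction L generalizing a with
  | nil => cases h; exact h'
  | cons s L ih => exact ⟨h.1, ih h.2⟩

theorem IsPath.whisker {a b : P.T} {L : List P.Step} (h : P.IsPath a L b) (x y : P.T) :
    P.IsPath (x * a * y) (L.map fun s => s.whisker x y) (x * b * y) := by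
  induction L generalizing a with
  | nil => cases h; rfl
  | cons s L ih =>
    obtain ⟨rfl, h⟩ := h
    have hs := ih h
    obtain ⟨e, b⟩ := s
    cases b
    · refine ⟨?_, ?_⟩
      · simp [Step.src, Step.whisker, Edge.whisker, Edge.tgt, mul_assoc]
      · convert hs using 1
        simp [Step.tgt, Step.whisker, Edge.whisker, Edge.src, mul_assoc]
    · refine ⟨?_, ?_⟩
      · simp [Step.src, Step.whisker, Edge.whisker, Edge.src, mul_assoc]
      · convert hs using 1
        simp [Step.tgt, Step.whisker, Edge.whisker, Edge.tgt, mul_assoc]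

theorem IsPath.reverse {a b : P.T} {L : List P.Step} (h : P.IsPath a L b) :
    P.IsPath b (L.map Step.rev).reverse a := by
  induction L generalizing a with
  | nil => exact Eq.symm h
  | cons s L ih =>
    obtain ⟨rfl, h⟩ := h
    rw [List.map_cons, List.reverse_cons]
    refine (ih h).append ?_
    obtain ⟨e, b⟩ := s
    cases b <;> simp [IsPath, Step.rev, Step.src, Step.tgt]

namespace EdgePath

/-- The constant path. -/
def const (a : P.T) : P.EdgePath := ⟨a, a, [], rfl⟩

/-- The path consisting of one edge. -/
def single (a : P.Edge) : P.EdgePath := ⟨a.src, a.tgt, [(a, true)], rfl, rfl⟩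

/-- Composition of edge paths. -/
def comp (α β : P.EdgePath) (h : α.tgt = β.src) : P.EdgePath :=
  ⟨α.src, β.tgt, α.steps ++ β.steps, α.isPath.append (h ▸ β.isPath)⟩

/-- The reverse of an edge path. -/
def reverse (α : P.EdgePath) : P.EdgePath :=
  ⟨α.tgt, α.src, (α.steps.map Step.rev).reverse, α.isPath.reverse⟩

/-- `x ▷ α ◁ y`. -/
def whisker (x : P.T) (α : P.EdgePath) (y : P.T) : P.EdgePath :=
  ⟨x * α.src * y, x * α.tgt * y, α.steps.map fun s => s.whisker x y, α.isPath.whisker x y⟩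

/-- `α ∗ β = (α ◁ βd) ∘ (αr ▷ β)`. -/
def star (α β : P.EdgePath) : P.EdgePath :=
  comp (whisker 1 α β.src) (whisker α.tgt β 1) (by simp [whisker])

end EdgePath

theorem Step.rev_whisker (x y : P.T) (s : P.Step) : (s.whisker x y).rev = s.rev.whisker x y := rfl

theorem Cell.whisker {C D : List P.Step} (h : P.Cell C D) (x y : P.T) :
    P.Cell (C.map fun s => s.whisker x y) (D.map fun s => s.whisker x y) := by
  obtain ⟨p, l, r, h, q, p', l', r', h', q'⟩ := h
  have := Cell.mk (P := P) (x * p) l r h q p' l' r' h' (q' * y)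
  simpa only [List.map_cons, List.map_nil, Step.whisker, Edge.whisker, mul_assoc] using this

theorem Step.whisker_whisker (x x' y y' : P.T) (s : P.Step) :
    (s.whisker x y).whisker x' y' = s.whisker (x' * x) (y * y') := by
  simp only [Step.whisker, Edge.whisker, mul_assoc]

namespace EdgePath

theorem whisker_whisker (x x' y y' : P.T) (α : P.EdgePath) :
    (α.whisker x y).whisker x' y' = α.whisker (x' * x) (y * y') := by
  ext1
  · simp only [whisker, mul_assoc]
  · simp only [whisker, mul_assoc]
  · simp only [whisker, List.map_map]
    exact List.map_congr_left fun s _ => Step.whisker_whisker x x' y y' s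

theorem equiv_src {α β : P.EdgePath} (h : α ≈ β) : α.src = β.src := by
  induction h with
  | rel _ _ h => cases h <;> assumption
  | refl => rfl
  | symm _ _ _ ih => exact ih.symm
  | trans _ _ _ _ _ ih₁ ih₂ => exact ih₁.trans ih₂

theorem equiv_tgt {α β : P.EdgePath} (h : α ≈ β) : α.tgt = β.tgt := by
  induction h with
  | rel _ _ h => cases h <;> assumption
  | refl => rfl
  | symm _ _ _ ih => exact ih.symm
  | trans _ _ _ _ _ ih₁ ih₂ => exact ih₁.trans ih₂

/-- A map of edge paths that rewrites the steps within a fixed context preserves homotopy. -/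
theorem equiv_map {F : P.EdgePath → P.EdgePath} {x y : P.T} {L₁ L₂ : List P.Step}
    {α β : P.EdgePath} (h : α ≈ β)
    (hs : ∀ α β : P.EdgePath, α.src = β.src → (F α).src = (F β).src)
    (ht : ∀ α β : P.EdgePath, α.tgt = β.tgt → (F α).tgt = (F β).tgt)
    (hF : ∀ γ : P.EdgePath, γ.src = α.src → γ.tgt = α.tgt →
      (F γ).steps = L₁ ++ (γ.steps.map fun s => s.whisker x y) ++ L₂) : F α ≈ F β := by
  suffices H : ∀ γ δ : P.EdgePath, Relation.EqvGen ElemHomotopy γ δ →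
      γ.src = α.src → γ.tgt = α.tgt → Relation.EqvGen ElemHomotopy (F γ) (F δ) from
    H α β h rfl rfl
  intro γ δ hγδ
  induction hγδ with
  | rel γ δ h =>
    intro h₁ h₂
    apply Relation.EqvGen.rel
    cases h with
    | cancel a b L L' s hγ hδ =>
      refine .cancel (hs _ _ a) (ht _ _ b) (L₁ ++ L.map fun s => s.whisker x y)
        ((L'.map fun s => s.whisker x y) ++ L₂) (s.whisker x y) ?_ ?_
      · rw [hF γ h₁ h₂, hγ, Step.rev_whisker]
        simp only [List.map_append, List.map_cons, List.map_nil, List.append_assoc]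
      · rw [hF δ (a ▸ h₁) (b ▸ h₂), hδ]
        simp only [List.map_append, List.append_assoc]
    | cell a b L L' C D h hγ hδ =>
      refine .cell (hs _ _ a) (ht _ _ b) (L₁ ++ L.map fun s => s.whisker x y)
        ((L'.map fun s => s.whisker x y) ++ L₂) _ _ (h.whisker x y) ?_ ?_
      · rw [hF γ h₁ h₂, hγ]
        simp only [List.map_append, List.append_assoc]
      · rw [hF δ (a ▸ h₁) (b ▸ h₂), hδ]
        simp only [List.map_append, List.append_assoc]
  | refl => intro _ _; exact .refl _
  | symm γ δ h ih =>
    intro h₁ h₂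
    exact .symm _ _ (ih ((equiv_src h).trans h₁) ((equiv_tgt h).trans h₂))
  | trans γ δ ε h h' ih ih' =>
    intro h₁ h₂
    exact .trans _ _ _ (ih h₁ h₂)
      (ih' ((equiv_src h).symm.trans h₁) ((equiv_tgt h).symm.trans h₂))

theorem whisker_equiv {α β : P.EdgePath} (h : α ≈ β) (x y : P.T) :
    α.whisker x y ≈ β.whisker x y :=
  equiv_map (F := fun γ => γ.whisker x y) (x := x) (y := y) (L₁ := []) (L₂ := []) h
    (fun _ _ h => by simp only [whisker, h]) (fun _ _ h => by simp only [whisker, h])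
    (fun γ _ _ => by simp only [whisker, List.nil_append, List.append_nil])

theorem star_equiv {α α' β β' : P.EdgePath} (h : α ≈ α') (h' : β ≈ β') :
    α.star β ≈ α'.star β' := by
  have h₁ : α.star β ≈ α'.star β :=
    equiv_map (F := fun γ => γ.star β) (x := 1) (y := β.src) (L₁ := [])
      (L₂ := β.steps.map fun s => s.whisker α.tgt 1) h
      (fun _ _ h => by simp only [star, comp, whisker, h])
      (fun _ _ h => by simp only [star, comp, whisker, h])
      (fun γ _ h => by simp only [star, comp, whisker, h, List.nil_append])
  have h₂ : α'.star β ≈ α'.star β' :=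
    equiv_map (F := fun γ => α'.star γ) (x := α'.tgt) (y := 1)
      (L₁ := α'.steps.map fun s => s.whisker 1 β.src) (L₂ := []) h'
      (fun _ _ h => by simp only [star, comp, whisker, h])
      (fun _ _ h => by simp only [star, comp, whisker, h])
      (fun γ h _ => by simp only [star, comp, whisker, h, List.append_nil])
  exact Setoid.trans h₁ h₂

theorem star_assoc (α β γ : P.EdgePath) : (α.star β).star γ = α.star (β.star γ) := by
  ext1
  · simp [star, comp, whisker, mul_assoc]
  · simp [star, comp, whisker, mul_assoc]
  · simp only [star, comp, whisker, List.map_append, List.map_map, List.append_assoc, mul_one,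
      one_mul]
    congr 1
    · exact List.map_congr_left fun s _ => by
        simp only [Function.comp, Step.whisker_whisker, mul_one]
    · congr 1
      · exact List.map_congr_left fun s _ => by
          simp only [Function.comp, Step.whisker_whisker, mul_one, one_mul]
      · exact List.map_congr_left fun s _ => by
          simp only [Function.comp, Step.whisker_whisker, mul_one]

theorem whisker_star (x y : P.T) (α β : P.EdgePath) :
    (α.star β).whisker x y = (α.whisker x 1).star (β.whisker 1 y) := by
  ext1
  · simp [star, comp, whisker, mul_assoc]
  · simp [star, comp, whisker, mul_assoc]
  · simp only [star, comp, whisker, List.map_append, List.map_map, mul_one, one_mul]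
    congr 1 <;> exact List.map_congr_left fun s _ => by
        simp only [Function.comp, Step.whisker_whisker, mul_one, one_mul]

theorem ψ_tgt (α : P.EdgePath) : P.ψ α.tgt = P.ψ α.src := by
  obtain ⟨a, b, L, h⟩ := α
  change P.ψ b = P.ψ a
  induction L generalizing a with
  | nil => cases h; rfl
  | cons s L ih =>
    obtain ⟨rfl, h⟩ := h
    rw [ih _ h]
    obtain ⟨e, b⟩ := s
    have := P.ψ_rel e.rel
    cases b <;> simp [Step.src, Step.tgt, Edge.src, Edge.tgt, this]

theorem steps_cancel {a b : P.T} {L : List P.Step} (h : P.IsPath a L b) (α β : P.EdgePath)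
    (h₁ : α.src = β.src) (h₂ : α.tgt = β.tgt) (hβ : β.steps = [])
    (hα : α.steps = (L.map Step.rev).reverse ++ L) : α ≈ β := by
  induction L generalizing a α with
  | nil =>
    have : α = β := EdgePath.ext h₁ h₂ (by rw [hα, hβ]; rfl)
    rw [this]
  | cons s L ih =>
    obtain ⟨rfl, h⟩ := h
    have hs : s.rev.rev = s := by obtain ⟨e, b⟩ := s; cases b <;> rfl
    have hp : P.IsPath b ((L.map Step.rev).reverse ++ L) b := h.reverse.append h
    have hb : α.src = b ∧ α.tgt = b := by
      have h3 := α.isPath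
      have h4 : P.IsPath b ((s :: L).map Step.rev).reverse s.src :=
        IsPath.reverse (L := s :: L) ⟨rfl, h⟩
      have h5 : α.src = α.tgt := by
        have := β.isPath
        rw [hβ] at this
        rw [h₁, h₂]
        exact this
      have h6 : ∀ (L : List P.Step) (a c d : P.T), P.IsPath a L c → P.IsPath a L d → c = d := by
        intro L
        induction L with
        | nil => intro a c d h h'; exact Eq.trans (Eq.symm h) h'
        | cons s L ih => intro a c d h h'; exact ih _ _ _ h.2 h'.2
      have h7 : ∀ (L L' : List P.Step) (a c d : P.T), L ≠ [] → P.IsPath a L c →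
          P.IsPath d (L ++ L') α.tgt → a = d := by
        intro L L' a c d hL h h'
        cases L with
        | nil => exact absurd rfl hL
        | cons s L => exact h.1.symm.trans h'.1
      rw [hα] at h3
      have h8 := h7 _ _ _ _ _ (by simp) h4 h3
      exact ⟨h8.symm, h5.symm.trans h8.symm⟩
    let γ : P.EdgePath := ⟨b, b, (L.map Step.rev).reverse ++ L, hp⟩
    have h3 : α ≈ γ := by
      apply Relation.EqvGen.rel
      refine .cancel hb.1 hb.2 (L.map Step.rev).reverse L s.rev ?_ rfl
      rw [hα, hs]
      simp
    exact Setoid.trans h3 (ih h γ (hb.1.symm.trans h₁) (hb.2.symm.trans h₂) rfl)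

end EdgePath

namespace Arrow

/-- The homotopy class of an edge path. -/
def mk (α : P.EdgePath) : P.Arrow := Quotient.mk P.homotopySetoid α

theorem mk_surjective : Function.Surjective (mk : P.EdgePath → P.Arrow) := Quotient.mk_surjective

/-- The domain of an arrow. -/
def d (α : P.Arrow) : P.T := Quotient.lift EdgePath.src (fun _ _ h => EdgePath.equiv_src h) α

/-- The range of an arrow. -/
def r (α : P.Arrow) : P.T := Quotient.lift EdgePath.tgt (fun _ _ h => EdgePath.equiv_tgt h) α

/-- `x ▷ α ◁ y`. -/
def whisker (x : P.T) (α : P.Arrow) (y : P.T) : P.Arrow :=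
  Quotient.map (fun α => EdgePath.whisker x α y) (fun _ _ h => EdgePath.whisker_equiv h x y) α

/-- `α ∗ β = (α ◁ βd) ∘ (αr ▷ β)`. -/
def star (α β : P.Arrow) : P.Arrow :=
  Quotient.map₂ EdgePath.star (fun _ _ h _ _ h' => EdgePath.star_equiv h h') α β

end Arrow

/-- The set `star_e^⋈ = {e ▷ α ◁ e : α ∈ star_e}` at an idempotent `e` of `𝓣`. -/
@[ext] structure Bowtie (P : Presentation X M) (e : Idem P.T) where
  val : P.Arrow
  mem : ∃ α : P.Arrow, α.d = e.val ∧ val = α.whisker e.val e.val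

namespace Bowtie

variable {e : Idem P.T}

theorem exists_rep (α : P.Bowtie e) : ∃ γ : P.EdgePath, α.val = Arrow.mk γ ∧ γ.src = e.val ∧
    γ.whisker e.val 1 = γ ∧ γ.whisker 1 e.val = γ := by
  obtain ⟨β, hβ, h⟩ := α.mem
  obtain ⟨γ, rfl⟩ := Arrow.mk_surjective β
  refine ⟨γ.whisker e.val e.val, h, ?_, ?_, ?_⟩
  · change e.val * γ.src * e.val = e.val
    rw [show γ.src = e.val from hβ, e.idem, e.idem]
  · rw [EdgePath.whisker_whisker, e.idem, mul_one]
  · rw [EdgePath.whisker_whisker, e.idem, one_mul]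

theorem of_rep (γ : P.EdgePath) (h : γ.src = e.val) (h₁ : γ.whisker e.val 1 = γ)
    (h₂ : γ.whisker 1 e.val = γ) :
    ∃ α : P.Arrow, α.d = e.val ∧ Arrow.mk γ = α.whisker e.val e.val := by
  refine ⟨Arrow.mk γ, h, ?_⟩
  have : γ.whisker e.val e.val = γ := by
    calc γ.whisker e.val e.val = (γ.whisker 1 e.val).whisker e.val 1 := by
          rw [EdgePath.whisker_whisker, mul_one]
      _ = γ := by rw [h₂, h₁]
  exact congrArg Arrow.mk this.symm

theorem tgt_mul_inv (γ : P.EdgePath) (h : γ.src = e.val) : γ.tgt * γ.tgt⁻¹ = e.val := by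
  apply P.idem_eq (idem_mul_inv _) e.idem
  rw [map_mul, map_inv', γ.ψ_tgt, h, ← map_inv', ← map_mul, inv_of_idem e.idem, e.idem]

theorem tgt_inv_mul (γ : P.EdgePath) (h : γ.src = e.val) : γ.tgt⁻¹ * γ.tgt = e.val := by
  apply P.idem_eq (idem_inv_mul _) e.idem
  rw [map_mul, map_inv', γ.ψ_tgt, h, ← map_inv', ← map_mul, inv_of_idem e.idem, e.idem]

instance : One (P.Bowtie e) where
  one :=
    { val := Arrow.mk (EdgePath.const e.val)
      mem := of_rep _ rfl
        (EdgePath.ext (by simp [EdgePath.whisker, EdgePath.const, e.idem])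
          (by simp [EdgePath.whisker, EdgePath.const, e.idem]) rfl)
        (EdgePath.ext (by simp [EdgePath.whisker, EdgePath.const, e.idem])
          (by simp [EdgePath.whisker, EdgePath.const, e.idem]) rfl) }

/-- The product of `star_e^⋈` is `∗`. -/
instance : Mul (P.Bowtie e) where
  mul α β :=
    { val := α.val.star β.val
      mem := by
        obtain ⟨γ, h, h₁, h₂, h₃⟩ := α.exists_rep
        obtain ⟨δ, h', h₁', h₂', h₃'⟩ := β.exists_rep
        rw [h, h']
        refine of_rep (γ.star δ) ?_ ?_ ?_
        · simp [EdgePath.star, EdgePath.comp, EdgePath.whisker, h₁, h₁', e.idem]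
        · rw [EdgePath.whisker_star, h₂]
          congr 1
          exact EdgePath.ext (by simp [EdgePath.whisker]) (by simp [EdgePath.whisker])
            (by simp [EdgePath.whisker, Step.whisker, Edge.whisker])
        · rw [EdgePath.whisker_star, h₃']
          congr 1
          exact EdgePath.ext (by simp [EdgePath.whisker]) (by simp [EdgePath.whisker])
            (by simp [EdgePath.whisker, Step.whisker, Edge.whisker]) }

theorem val_mul (α β : P.Bowtie e) : (α * β).val = α.val.star β.val := rfl

theorem exists_inv (α : P.Bowtie e) : ∃ β : P.Bowtie e, β * α = 1 := by
  obtain ⟨γ, h, h₁, h₂, h₃⟩ := α.exists_rep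
  have ht := tgt_inv_mul γ h₁
  have ht' := tgt_mul_inv γ h₁
  have hr : γ.reverse.whisker 1 e.val = γ.reverse := by
    conv_rhs => rw [← h₃]
    exact EdgePath.ext rfl rfl (by simp [EdgePath.whisker, EdgePath.reverse]; exact fun _ => ⟨fun _ => rfl, fun _ => rfl⟩)
  have hee : e.val * γ.tgt⁻¹ = γ.tgt⁻¹ := by rw [← ht, inv_mul_inv]
  have hee' : γ.tgt⁻¹ * e.val = γ.tgt⁻¹ := by rw [← ht', ← mul_assoc, inv_mul_inv]
  refine ⟨⟨Arrow.mk (γ.reverse.whisker γ.tgt⁻¹ e.val), of_rep _ ?_ ?_ ?_⟩, ?_⟩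
  · change γ.tgt⁻¹ * γ.tgt * e.val = e.val
    rw [ht, e.idem]
  · rw [EdgePath.whisker_whisker, hee, mul_one]
  · rw [EdgePath.whisker_whisker, e.idem, one_mul]
  · apply Bowtie.ext
    rw [val_mul, h]
    change Arrow.mk ((γ.reverse.whisker γ.tgt⁻¹ e.val).star γ) = Arrow.mk (.const e.val)
    refine Quotient.sound (s := P.homotopySetoid) ?_
    have hp := γ.isPath.whisker γ.tgt⁻¹ 1
    refine EdgePath.steps_cancel hp _ _ ?_ ?_ rfl ?_
    · simp [EdgePath.star, EdgePath.comp, EdgePath.whisker, EdgePath.const, EdgePath.reverse, ht,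
        h₁, e.idem]
    · simp [EdgePath.star, EdgePath.comp, EdgePath.whisker, EdgePath.const, EdgePath.reverse, h₁,
        hee', ht]
    · have hs : ∀ s ∈ γ.steps, s.whisker 1 e.val = s := by
        have := congrArg EdgePath.steps h₃
        intro s hs
        exact List.map_inj_left.1 (this.trans (List.map_id _).symm) s hs
      simp only [EdgePath.star, EdgePath.comp, EdgePath.whisker, EdgePath.reverse, h₁, hee',
        List.map_reverse, List.map_map]
      congr 2
      refine List.map_congr_left fun s hs' => ?_
      simp only [Function.comp, Step.whisker_whisker, one_mul, e.idem, Step.rev_whisker]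
      conv_rhs => rw [← hs s hs', ← Step.rev_whisker, Step.whisker_whisker]
      simp [Step.rev_whisker]

/-- `star_e^⋈` is a group under `∗`. -/
noncomputable instance : Group (P.Bowtie e) :=
  @Group.ofLeftAxioms (P.Bowtie e) _ ⟨fun α => α.exists_inv.choose⟩ _
    (fun α β γ => by
      apply Bowtie.ext
      obtain ⟨⟨α⟩, _⟩ := α
      obtain ⟨⟨β⟩, _⟩ := β
      obtain ⟨⟨γ⟩, _⟩ := γ
      exact congrArg Arrow.mk (EdgePath.star_assoc α β γ))
    (fun α => by
      apply Bowtie.ext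
      obtain ⟨γ, h, h₁, h₂, -⟩ := α.exists_rep
      change Arrow.star (Arrow.mk (EdgePath.const e.val)) α.val = α.val
      rw [h]
      refine congrArg Arrow.mk ?_
      conv_rhs => rw [← h₂]
      exact EdgePath.ext (by simp [EdgePath.star, EdgePath.comp, EdgePath.whisker, EdgePath.const])
        (by simp [EdgePath.star, EdgePath.comp, EdgePath.whisker, EdgePath.const])
        (by simp [EdgePath.star, EdgePath.comp, EdgePath.whisker, EdgePath.const]))
    (fun α => α.exists_inv.choose_spec)

end Bowtie

variable (P)

/-- The component at `e ∈ E(M)` of `(S^⋈)^ab`, written additively; `S^⋈` is the disjoint union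
of the groups `star_e^⋈`, whose indexing set `E(𝓣)` is identified with `E(M)` by `ψ`. -/
abbrev Sab (e : Idem M) : Type _ := Additive (Abelianization (P.Bowtie (P.lift e)))

/-- The image of `α` in `(star_e^⋈)^ab`. -/
noncomputable def bar {e : Idem M} (α : P.Bowtie (P.lift e)) : P.Sab e := Additive.ofMul (Abelianization.of α)

/-- The component `Z_e` of the `E(M)`-set `𝓩`: the relations `(l, r)` with `(l⁻¹ r) ρτψ = e`. -/
structure Z (e : Idem M) where
  l : Word X
  r : Word X
  rel : (l, r) ∈ P.rels
  eq : P.ψ (P.ρτ (l.inv * r)) = e.val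

/-- The set `Y_e` of triples `(l, r, m)` with `(l⁻¹ r) ρτψ ≥ m m⁻¹` and `m⁻¹ m = e`. -/
structure Y (e : Idem M) where
  l : Word X
  r : Word X
  m : M
  rel : (l, r) ∈ P.rels
  le : NatLE (m * m⁻¹) (P.ψ (P.ρτ (l.inv * r)))
  eq : m⁻¹ * m = e.val

variable {P}

/-- The homotopy class of the edge `(u⁻¹ l⁻¹, l, r, u)`. -/
def generator {l r : Word X} (h : (l, r) ∈ P.rels) (u : P.T) : P.Arrow :=
  Arrow.mk (EdgePath.single ⟨u⁻¹ * P.ρτ l.inv, l, r, u, h⟩)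

end Presentation

end InverseMonoid

open InverseMonoid

namespace InverseMonoid

/-! ### Identities in an inverse monoid -/

section Basic

variable {S : Type*} [InverseMonoid S]

/-! The proof shows that the classes of the edges `(u⁻¹ l⁻¹, l, r, u)` form a basis of each
abelianised group, and reads the module structure off that basis.

Independence comes from an invariant. Give an edge `(p, l, r, q)` the triple `(l, r, (q ψ) m)`, with
a minus sign when it is run backwards, and add along a path. This weight survives homotopy: the left
coordinate `p` is forgotten, and across a 2-cell the right coordinate only has `l'` exchanged for
`r'`, which agree in `M` (`EdgePath.weight_eq_of_equiv`). It is additive for `∗` on `star_e^⋈`, so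
it factors through the abelianisation, and it sends the generator at `u` to the basis element `(l,
r, u ψ)`.

The generator depends on `u ψ` only. If `u` and `v` have the same image, a path `δ` joins `e` to
`u⁻¹ v`, and the interchange law gives `g_u ∗ δ = δ ∗ g_v`; in the abelianisation `δ` cancels
(`bar_generatorBowtie_eq`).

For generation, every vertex of a path starting at `e` lies over `e ψ`. Such a path is cut into
steps, and each step is translated on the left by the inverse of its start so as to begin at `e`.
Composition becomes `∗` and reversal becomes inversion (`Bowtie.shift_comp`,
`Bowtie.shift_reverse`), and a translated edge `(p, l, r, q)` is exactly the generator with `u = q`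
(`bar_shift_single_mem`).

The Lausch structure is then transported from the free module. The weight is injective on the
abelianisation (`sabWeight_injective`), so the formula for the action is verified by comparing
weights. -/

theorem inv_mul_eq_of_conj {p c q e : S} (h : (p * c * q)⁻¹ * (p * c * q) = e) (hq : q * e = q) :
    q⁻¹ * q = e := by
  have he : q⁻¹ * q * e = e := by
    rw [← h]
    simp only [mul_inv_rev', mul_assoc, inv_mul_cancel']
  rw [← he, mul_assoc, hq]

/-- Expanding `q = q e` and commuting `q q⁻¹` past `(p c)⁻¹ (p c)` exhibits `q` as a product
beginning with `c⁻¹`. With `c` the image of `l`, this puts the triple of an edge `(p, l, r, q)` in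
`Y_e`. -/
theorem inv_mul_mul_eq_of_conj {p c q e : S} (h : (p * c * q)⁻¹ * (p * c * q) = e)
    (hq : q * e = q) : c⁻¹ * c * q = q := by
  have key : q = c⁻¹ * p⁻¹ * p * c * q := by
    calc q = (q * q⁻¹) * ((p * c)⁻¹ * (p * c)) * q := by
          conv_lhs => rw [← hq, ← h]
          simp only [mul_inv_rev', mul_assoc]
      _ = ((p * c)⁻¹ * (p * c)) * (q * q⁻¹ * q) := by
          rw [idem_comm (idem_mul_inv q) (idem_inv_mul (p * c))]; simp only [mul_assoc]
      _ = _ := by rw [mul_inv_mul]; simp only [mul_inv_rev', mul_assoc]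
  rw [key]
  simp only [mul_assoc, inv_mul_cancel']

/-- The same argument gives `c q = p⁻¹ p (c q)`, and the claim follows by inverting. It makes the
left coordinate `p` of an edge disappear after translation to `e`. -/
theorem inv_mul_left_eq_of_conj {p c q e : S} (h : (p * c * q)⁻¹ * (p * c * q) = e)
    (hq : q * e = q) : (p * c * q)⁻¹ * p = q⁻¹ * c⁻¹ := by
  have key : c * q = p⁻¹ * p * (c * q) := by
    calc c * q = ((c * q) * (c * q)⁻¹) * (p⁻¹ * p) * (c * q) := by
          conv_lhs => rw [← hq, ← h]
          simp only [mul_inv_rev', mul_assoc]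
      _ = (p⁻¹ * p) * ((c * q) * (c * q)⁻¹ * (c * q)) := by
          rw [idem_comm (idem_mul_inv (c * q)) (idem_inv_mul p)]; simp only [mul_assoc]
      _ = _ := by rw [mul_inv_mul]
  have := congrArg (·⁻¹) key
  simp only [mul_inv_rev', inv_inv', mul_assoc] at this
  rw [this]
  simp only [mul_inv_rev', mul_assoc]

theorem mul_eq_of_natLE {f m : S} (hf : f * f = f) (h : NatLE (m * m⁻¹) f) : f * m = m := by
  obtain ⟨g, -, hg⟩ := h
  calc f * m = f * (m * m⁻¹) * m := by rw [mul_assoc, mul_inv_mul]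
    _ = f * f * g * m := by rw [hg]; simp only [mul_assoc]
    _ = m := by rw [hf, ← hg, mul_inv_mul]

theorem FIM.rho_inv {X : Type*} (w : Word X) : FIM.rho X w.inv = (FIM.rho X w)⁻¹ := rfl

end Basic

namespace Presentation

variable {X M : Type*} [InverseMonoid M] {P : Presentation X M}

/-! ### The maps `ρτ` and `ψ`, and idempotent separation -/

theorem ρτ_inv (w : Word X) : P.ρτ w.inv = (P.ρτ w)⁻¹ := by
  simp only [ρτ, MonoidHom.comp_apply, FIM.rho_inv, map_inv']

theorem ψ_surjective (P : Presentation X M) : Function.Surjective P.ψ := fun m => by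
  obtain ⟨a, ha⟩ := P.surjective m
  exact ⟨P.τ a, ha⟩

theorem mul_inv_eq_of_ψ_eq {s t : P.T} (h : P.ψ s = P.ψ t) : s * s⁻¹ = t * t⁻¹ :=
  P.idem_eq (idem_mul_inv _) (idem_mul_inv _) (by simp only [map_mul, map_inv', h])

theorem inv_mul_eq_of_ψ_eq {s t : P.T} (h : P.ψ s = P.ψ t) : s⁻¹ * s = t⁻¹ * t :=
  P.idem_eq (idem_inv_mul _) (idem_inv_mul _) (by simp only [map_mul, map_inv', h])

/-- Because `ψ` separates idempotents, the elements of `𝓣` over `e ψ` form a group with identity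
`e`; this and the next three lemmas are its laws. -/
theorem mul_inv_eq_of_ψ_eq_idem {e : Idem P.T} {t : P.T} (h : P.ψ t = P.ψ e.val) :
    t * t⁻¹ = e.val := by
  rw [mul_inv_eq_of_ψ_eq h, inv_of_idem e.idem, e.idem]

theorem inv_mul_eq_of_ψ_eq_idem {e : Idem P.T} {t : P.T} (h : P.ψ t = P.ψ e.val) :
    t⁻¹ * t = e.val := by
  rw [inv_mul_eq_of_ψ_eq h, inv_of_idem e.idem, e.idem]

theorem idem_mul_of_ψ_eq {e : Idem P.T} {t : P.T} (h : P.ψ t = P.ψ e.val) : e.val * t = t := by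
  rw [← mul_inv_eq_of_ψ_eq_idem h, mul_inv_mul]

theorem mul_idem_of_ψ_eq {e : Idem P.T} {t : P.T} (h : P.ψ t = P.ψ e.val) : t * e.val = t := by
  rw [← inv_mul_eq_of_ψ_eq_idem h, ← mul_assoc, mul_inv_mul]

/-- In `M` the word `r` may be replaced by `l`; so `l⁻¹ r` has idempotent image there. -/
theorem ψ_inv_mul_rel {l r : Word X} (h : (l, r) ∈ P.rels) :
    P.ψ (P.ρτ (l.inv * r)) = P.ψ ((P.ρτ l)⁻¹ * P.ρτ l) := by
  rw [map_mul, map_mul, map_mul, ← P.ψ_rel h, ρτ_inv]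

theorem idem_ψ_inv_mul_rel {l r : Word X} (h : (l, r) ∈ P.rels) :
    P.ψ (P.ρτ (l.inv * r)) * P.ψ (P.ρτ (l.inv * r)) = P.ψ (P.ρτ (l.inv * r)) := by
  rw [ψ_inv_mul_rel h, ← map_mul, idem_inv_mul]

/-! ### Edge paths -/

theorem Step.rev_src (s : P.Step) : s.rev.src = s.tgt := by
  obtain ⟨a, b⟩ := s
  cases b <;> simp [rev, src, tgt]

theorem Step.rev_tgt (s : P.Step) : s.rev.tgt = s.src := by
  obtain ⟨a, b⟩ := s
  cases b <;> simp [rev, src, tgt]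

theorem Step.whisker_src (x y : P.T) (s : P.Step) : (s.whisker x y).src = x * s.src * y := by
  obtain ⟨a, b⟩ := s
  cases b <;> simp [src, Edge.src, Edge.tgt, whisker, Edge.whisker, mul_assoc]

theorem Step.whisker_tgt (x y : P.T) (s : P.Step) : (s.whisker x y).tgt = x * s.tgt * y := by
  obtain ⟨a, b⟩ := s
  cases b <;> simp [tgt, Edge.src, Edge.tgt, whisker, Edge.whisker, mul_assoc]

theorem isPath_append {a b : P.T} {L L' : List P.Step} :
    P.IsPath a (L ++ L') b ↔ ∃ c, P.IsPath a L c ∧ P.IsPath c L' b := by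
  refine ⟨fun h => ?_, fun ⟨c, h, h'⟩ => h.append h'⟩
  induction L generalizing a with
  | nil => exact ⟨a, rfl, h⟩
  | cons s L ih =>
    obtain ⟨c, h₁, h₂⟩ := ih h.2
    exact ⟨c, ⟨h.1, h₁⟩, h₂⟩

/-- Two vertices of the Squier complex with the same image in `M` are joined by an edge path. -/
theorem exists_isPath {a b : P.T} (h : P.ψ a = P.ψ b) : ∃ L, P.IsPath a L b := by
  -- Being joined by an edge path after `τ` is a congruence containing the relations, hence contains
  -- the kernel of `θ`, which they generate.
  let c : Con (FIM X) :=
    { r := fun x y => ∃ L, P.IsPath (P.τ x) L (P.τ y)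
      iseqv :=
        { refl := fun x => ⟨[], rfl⟩
          symm := fun ⟨_, h⟩ => ⟨_, h.reverse⟩
          trans := fun ⟨_, h⟩ ⟨_, h'⟩ => ⟨_, h.append h'⟩ }
      mul' := by
        rintro w x y z ⟨L, h⟩ ⟨L', h'⟩
        have h₁ := h.whisker 1 (P.τ y)
        have h₂ := h'.whisker (P.τ x) 1
        simp only [one_mul, mul_one] at h₁ h₂
        rw [map_mul, map_mul]
        exact ⟨_, h₁.append h₂⟩ }
  have hc : Con.ker P.θ ≤ c := by
    rw [P.ker_eq]
    refine Con.conGen_le.2 ?_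
    rintro _ _ ⟨⟨l, r⟩, hw, rfl, rfl⟩
    refine ⟨[(⟨1, l, r, 1, hw⟩, true)], ?_, ?_⟩
    · simp [Step.src, Edge.src, ρτ]
    · simp [Step.tgt, Edge.tgt, ρτ, IsPath]
  obtain ⟨x, rfl⟩ := P.τ_surjective a
  obtain ⟨y, rfl⟩ := P.τ_surjective b
  exact hc h

namespace EdgePath

theorem equiv_of_cell {α β : P.EdgePath} (h₁ : α.src = β.src) (h₂ : α.tgt = β.tgt)
    (L L' : List P.Step) {C D : List P.Step} (h : P.Cell C D) (hα : α.steps = L ++ C ++ L')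
    (hβ : β.steps = L ++ D ++ L') : α ≈ β :=
  Relation.EqvGen.rel _ _ (.cell h₁ h₂ L L' C D h hα hβ)

theorem equiv_of_cancel {α β : P.EdgePath} (h₁ : α.src = β.src) (h₂ : α.tgt = β.tgt)
    (L L' : List P.Step) (s : P.Step) (hα : α.steps = L ++ [s, s.rev] ++ L')
    (hβ : β.steps = L ++ L') : α ≈ β :=
  Relation.EqvGen.rel _ _ (.cancel h₁ h₂ L L' s hα hβ)

end EdgePath

/-- An edge may be moved past a step in either direction. -/
theorem equiv_swap_step (a : P.Edge) (s : P.Step) (α β : P.EdgePath) (h₁ : α.src = β.src)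
    (h₂ : α.tgt = β.tgt) (L L' : List P.Step)
    (hα : α.steps = L ++ [(a.whisker 1 s.src, true), s.whisker a.tgt 1] ++ L')
    (hβ : β.steps = L ++ [s.whisker a.src 1, (a.whisker 1 s.tgt, true)] ++ L') : α ≈ β := by
  obtain ⟨p, l, r, q, h⟩ := a
  obtain ⟨⟨p', l', r', q', h'⟩, b⟩ := s
  have hc' := Cell.mk p l r h q p' l' r' h' q'
  cases b
  -- The 2-cell equates `C B` with `D A`, all run forwards. For a backward second step, insert `B
  -- B⁻¹` to get `D⁻¹ C ≈ D⁻¹ C B B⁻¹ ≈ D⁻¹ D A B⁻¹ ≈ A B⁻¹`.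
  · let A : P.Step := (⟨p, l, r, q * p' * P.ρτ r' * q', h⟩, true)
    let B : P.Step := (⟨p * P.ρτ r * q * p', l', r', q', h'⟩, true)
    let C : P.Step := (⟨p, l, r, q * p' * P.ρτ l' * q', h⟩, true)
    let D : P.Step := (⟨p * P.ρτ l * q * p', l', r', q', h'⟩, true)
    have hα' : α.steps = L ++ [A, B.rev] ++ L' := by
      rw [hα]
      simp [A, B, Step.rev, Step.whisker, Edge.whisker, Step.src, Edge.tgt, mul_assoc]
    have hβ' : β.steps = L ++ [D.rev, C] ++ L' := by
      rw [hβ]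
      simp [C, D, Step.rev, Step.whisker, Edge.whisker, Step.tgt, Edge.src, mul_assoc]
    have hCB : C.tgt = B.src := by simp [B, C, Step.src, Step.tgt, Edge.src, Edge.tgt, mul_assoc]
    have hDA : D.tgt = A.src := by simp [A, D, Step.src, Step.tgt, Edge.src, Edge.tgt, mul_assoc]
    have hAB : A.tgt = B.tgt := by simp [A, B, Step.tgt, Edge.tgt, mul_assoc]
    have hp := β.isPath
    rw [hβ', List.append_assoc, isPath_append] at hp
    obtain ⟨c, hc, hD, hC, hL'⟩ := hp
    let γ : P.EdgePath := ⟨β.src, β.tgt, L ++ ([D.rev] ++ [C, B] ++ [B.rev] ++ L'),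
      hc.append ⟨hD, hC, hCB.symm, Step.rev_src B, (Step.rev_tgt B).trans hCB.symm ▸ hL'⟩⟩
    let δ : P.EdgePath := ⟨β.src, β.tgt, L ++ ([D.rev] ++ [D, A] ++ [B.rev] ++ L'),
      hc.append ⟨hD, (Step.rev_tgt D).symm, hDA.symm, (Step.rev_src B).trans hAB.symm,
        (Step.rev_tgt B).trans hCB.symm ▸ hL'⟩⟩
    have e₁ : γ ≈ β := EdgePath.equiv_of_cancel rfl rfl (L ++ [D.rev, C]) L' B
      (by simp [γ]) (by rw [hβ'])
    have e₂ : γ ≈ δ := EdgePath.equiv_of_cell rfl rfl (L ++ [D.rev]) ([B.rev] ++ L') hc'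
      (by simp [γ, C, B]) (by simp [δ, D, A])
    have e₃ : δ ≈ α := EdgePath.equiv_of_cancel h₁.symm h₂.symm L ([A, B.rev] ++ L') D.rev
      (by simp [δ, Step.rev]) (by rw [hα']; simp)
    exact Setoid.trans (Setoid.symm e₃) (Setoid.trans (Setoid.symm e₂) e₁)
  · refine EdgePath.equiv_of_cell h₁ h₂ L L' hc' ?_ ?_
    · rw [hα]
      simp [Step.whisker, Edge.whisker, Step.src, Edge.src, Edge.tgt, mul_assoc]
    · rw [hβ]
      simp [Step.whisker, Edge.whisker, Step.tgt, Edge.src, Edge.tgt, mul_assoc]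

/-- The interchange law for an edge and an edge path. -/
theorem equiv_swap (a : P.Edge) {x y : P.T} {D : List P.Step} (hD : P.IsPath x D y)
    (L : List P.Step) (α β : P.EdgePath) (h₁ : α.src = β.src) (h₂ : α.tgt = β.tgt)
    (hα : α.steps = L ++ (a.whisker 1 x, true) :: D.map fun s => s.whisker a.tgt 1)
    (hβ : β.steps = L ++ (D.map fun s => s.whisker a.src 1) ++ [(a.whisker 1 y, true)]) :
    α ≈ β := by
  induction D generalizing x L α with
  | nil =>
    cases hD
    have : α = β := EdgePath.ext h₁ h₂ (by rw [hα, hβ]; simp)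
    rw [this]
  | cons s D ih =>
    obtain ⟨rfl, hD⟩ := hD
    -- The intermediate path, with the edge moved past the first step only.
    let γ : P.EdgePath := ⟨α.src, α.tgt,
      L ++ [s.whisker a.src 1, (a.whisker 1 s.tgt, true)] ++ D.map fun s => s.whisker a.tgt 1, by
        have h := α.isPath
        rw [hα, isPath_append] at h
        obtain ⟨c, hc, hs, hs', h⟩ := h
        rw [List.append_assoc]
        refine hc.append ⟨?_, ?_, ?_⟩
        · rw [Step.whisker_src, ← hs]
          simp [Step.src, Edge.src, Edge.whisker, mul_assoc]
        · rw [Step.whisker_tgt]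
          simp [Step.src, Edge.src, Edge.whisker, mul_assoc]
        · rw [Step.whisker_tgt] at h
          convert h using 1
          · simp [Step.tgt, Edge.tgt, Edge.whisker, mul_assoc]
          · rfl⟩
    refine Setoid.trans (equiv_swap_step a s α γ rfl rfl L (D.map fun s => s.whisker a.tgt 1)
      (by rw [hα]; simp) rfl) ?_
    exact ih hD (L ++ [s.whisker a.src 1]) γ h₁ h₂ (by simp [γ]) (by rw [hβ]; simp)

/-! ### The weight of an edge path -/

/-- The signed triple `± (l, r, (q ψ) m)` of a step along or against the edge `(p, l, r, q)`. -/
def Step.weight (m : M) (s : P.Step) : FreeAbelianGroup (Word X × Word X × M) :=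
  if s.2 then .of (s.1.l, s.1.r, P.ψ s.1.q * m) else -.of (s.1.l, s.1.r, P.ψ s.1.q * m)

/-- The sum of the signed triples of the steps of an edge path. -/
def EdgePath.weight (m : M) (α : P.EdgePath) : FreeAbelianGroup (Word X × Word X × M) :=
  (α.steps.map (Step.weight m)).sum

/-- A step and its reverse have opposite weights. On the two sides of a 2-cell the edges of the
second relation differ only in the left coordinate, which is not recorded; those of the first differ
by `l'` against `r'` in the right coordinate, which `ψ` identifies. -/
theorem EdgePath.weight_eq_of_equiv {α β : P.EdgePath} (h : α ≈ β) (m : M) :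
    α.weight m = β.weight m := by
  induction h with
  | rel _ _ h =>
    cases h with
    | cancel _ _ L L' s hα hβ =>
      obtain ⟨a, b⟩ := s
      cases b <;> simp [weight, hα, hβ, Step.rev, Step.weight]
    | cell _ _ L L' C D h hα hβ =>
      obtain ⟨p, l, r, h, q, p', l', r', h', q'⟩ := h
      have := P.ψ_rel h'
      simp only at this
      simp [weight, hα, hβ, Step.weight, this]
      abel
  | refl => rfl
  | symm _ _ _ ih => exact ih.symm
  | trans _ _ _ _ _ ih₁ ih₂ => exact ih₁.trans ih₂

theorem Step.weight_whisker (m : M) (x y : P.T) (s : P.Step) :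
    (s.whisker x y).weight m = s.weight (P.ψ y * m) := by
  simp [Step.weight, Step.whisker, Edge.whisker, mul_assoc]

theorem EdgePath.weight_whisker (m : M) (x y : P.T) (α : P.EdgePath) :
    (α.whisker x y).weight m = α.weight (P.ψ y * m) := by
  simp [EdgePath.weight, EdgePath.whisker, Function.comp_def, Step.weight_whisker]

/-- Of the two whiskerings in `α ∗ β`, the left one is invisible to the weight and the right one by
`βd` only changes the parameter. -/
theorem EdgePath.weight_star (m : M) (α β : P.EdgePath) :
    (α.star β).weight m = α.weight (P.ψ β.src * m) + β.weight m := by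
  simp [EdgePath.weight, EdgePath.star, EdgePath.comp, EdgePath.whisker, Function.comp_def,
    Step.weight_whisker]

/-- Right multiplication on the third coordinate is how the free Lausch module acts on its basis;
this translates it into a change of parameter. -/
theorem EdgePath.map_weight (m n : M) (α : P.EdgePath) :
    FreeAbelianGroup.map (fun x : Word X × Word X × M => (x.1, x.2.1, x.2.2 * n)) (α.weight m) =
      α.weight (m * n) := by
  simp only [weight, map_list_sum, List.map_map]
  congr 2
  funext s
  simp only [Function.comp, Step.weight]
  split <;> simp [FreeAbelianGroup.map_of_apply, mul_assoc]

/-- The weight of a homotopy class of edge paths. -/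
def Arrow.weight (m : M) (α : P.Arrow) : FreeAbelianGroup (Word X × Word X × M) :=
  Quotient.lift (EdgePath.weight m) (fun _ _ h => EdgePath.weight_eq_of_equiv h m) α

theorem Arrow.map_weight (m n : M) (α : P.Arrow) :
    FreeAbelianGroup.map (fun x : Word X × Word X × M => (x.1, x.2.1, x.2.2 * n)) (α.weight m) =
      α.weight (m * n) := by
  obtain ⟨α, rfl⟩ := Arrow.mk_surjective α
  exact α.map_weight m n

theorem Arrow.weight_whisker (m : M) (x y : P.T) (α : P.Arrow) :
    (α.whisker x y).weight m = α.weight (P.ψ y * m) := by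
  obtain ⟨α, rfl⟩ := Arrow.mk_surjective α
  exact α.weight_whisker m x y

/-- The weight as a homomorphism on `star_e^⋈`. -/
noncomputable def Bowtie.weight (e : Idem P.T) :
    P.Bowtie e →* Multiplicative (FreeAbelianGroup (Word X × Word X × M)) :=
  MonoidHom.mk' (fun α => .ofAdd (α.val.weight (P.ψ e.val))) fun α β => by
    obtain ⟨γ, h, -⟩ := α.exists_rep
    obtain ⟨δ, h', hs, -⟩ := β.exists_rep
    rw [← ofAdd_add]
    congr 1
    rw [val_mul, h, h']
    refine (EdgePath.weight_star _ γ δ).trans ?_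
    -- The second factor starts at `e`, so its effect on the parameter `e ψ` is trivial.
    rw [hs, ← map_mul, e.idem]
    rfl

/-- The weight as a homomorphism on the abelianisation of `star_e^⋈`. -/
noncomputable def sabWeight (e : Idem M) : P.Sab e →+ FreeAbelianGroup (Word X × Word X × M) :=
  MonoidHom.toAdditiveLeft (Abelianization.lift (Bowtie.weight (P.lift e)))

theorem sabWeight_bar {e : Idem M} (α : P.Bowtie (P.lift e)) :
    sabWeight e (P.bar α) = α.val.weight e.val := by
  have h := P.ψ_lift e
  conv_rhs => rw [← h]
  rfl

end Presentation

/-! ### Transport of Lausch modules -/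

section Transport

variable {S : Type*} [InverseMonoid S] {A B : Idem S → Type*} [∀ e, AddCommGroup (A e)]
  [∀ e, AddCommGroup (B e)]

/-- The map of disjoint unions induced by isomorphisms at each idempotent. -/
def sigmaMap (φ : ∀ e, A e ≃+ B e) (a : Σ e, A e) : Σ e, B e := ⟨a.1, φ a.1 a.2⟩

theorem sigmaMap_symm_sigmaMap (φ : ∀ e, A e ≃+ B e) (a : Σ e, A e) :
    sigmaMap (fun e => (φ e).symm) (sigmaMap φ a) = a :=
  Sigma.ext rfl (heq_of_eq ((φ a.1).symm_apply_apply a.2))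

theorem sigmaMap_sigmaMap_symm (φ : ∀ e, A e ≃+ B e) (b : Σ e, B e) :
    sigmaMap φ (sigmaMap (fun e => (φ e).symm) b) = b :=
  Sigma.ext rfl (heq_of_eq ((φ b.1).apply_symm_apply b.2))

/-- The presheaf structure transported along isomorphisms of the groups at each idempotent. -/
def LauschPresheaf.transport (L : LauschPresheaf S A) (φ : ∀ e, A e ≃+ B e) :
    LauschPresheaf S B where
  res {e f} h := ((φ f).toAddMonoidHom.comp (L.res h)).comp (φ e).symm.toAddMonoidHom
  res_refl e a := by simp [L.res_refl]
  res_trans h h' a := by simp [L.res_trans]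

theorem LauschPresheaf.transport_oplus (L : LauschPresheaf S A) (φ : ∀ e, A e ≃+ B e)
    (a b : Σ e, A e) :
    (L.transport φ).oplus (sigmaMap φ a) (sigmaMap φ b) = sigmaMap φ (L.oplus a b) := by
  refine Sigma.ext rfl (heq_of_eq ?_)
  refine Eq.trans (congrArg₂ (· + ·) ?_ ?_) (map_add (φ (a.1.mul b.1)) _ _).symm
  · exact congrArg (fun x => φ _ (L.res _ x)) ((φ a.1).symm_apply_apply a.2)
  · exact congrArg (fun x => φ _ (L.res _ x)) ((φ b.1).symm_apply_apply b.2)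

theorem sigmaMap_zero (φ : ∀ e, A e ≃+ B e) (e : Idem S) :
    sigmaMap φ ⟨e, 0⟩ = ⟨e, 0⟩ := by
  simp [sigmaMap]

/-- The Lausch module structure transported along isomorphisms of the groups at each idempotent. -/
def LauschModule.transport (L : LauschModule S A) (φ : ∀ e, A e ≃+ B e) : LauschModule S B where
  toLauschPresheaf := L.toLauschPresheaf.transport φ
  act a s := sigmaMap φ (L.act (sigmaMap (fun e => (φ e).symm) a) s)
  oplus_act a b s := by
    -- Once every element is written as an image under `φ`, the axiom reduces to that of `L`.
    rw [← sigmaMap_sigmaMap_symm φ a, ← sigmaMap_sigmaMap_symm φ b,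
      LauschPresheaf.transport_oplus]
    simp only [sigmaMap_symm_sigmaMap]
    rw [L.oplus_act, LauschPresheaf.transport_oplus]
  act_mul a s t := by
    rw [L.act_mul, sigmaMap_symm_sigmaMap]
  act_idem a e := by
    rw [L.act_idem, ← LauschPresheaf.transport_oplus, sigmaMap_sigmaMap_symm, sigmaMap_zero]
  zero_act e s := by
    rw [sigmaMap_zero, L.zero_act, sigmaMap_zero]

/-- A Lausch module is isomorphic to its transport. -/
def LauschModule.transportIso (L : LauschModule S A) (φ : ∀ e, A e ≃+ B e) :
    LauschIso L (L.transport φ) where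
  equiv := φ
  map_res h a := by simp [LauschModule.transport, LauschPresheaf.transport]
  map_act e a s := by
    change sigmaMap φ (L.act ⟨e, a⟩ s) = sigmaMap φ (L.act (sigmaMap _ (sigmaMap φ ⟨e, a⟩)) s)
    rw [sigmaMap_symm_sigmaMap]

end Transport

/-! ### Fixed edge paths and the generators -/

namespace Presentation

variable {X M : Type*} [InverseMonoid M] {P : Presentation X M}

/-- The edges `(p, l, r, q)` of an edge path all satisfy `e p = p` and `q e = q`. -/
def EdgePath.Fixed (e : Idem P.T) (γ : P.EdgePath) : Prop :=
  ∀ s ∈ γ.steps, e.val * s.1.p = s.1.p ∧ s.1.q * e.val = s.1.q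

namespace Bowtie

variable {e : Idem P.T}

/-- The element of `star_e^⋈` represented by an edge path that starts at `e`. -/
def ofPath (γ : P.EdgePath) (h : γ.src = e.val)
    (hs : γ.Fixed e) : P.Bowtie e where
  val := Arrow.mk γ
  mem := by
    -- The end of the path lies over `e ψ`, hence absorbs `e` on both sides.
    have ht : P.ψ γ.tgt = P.ψ e.val := by rw [γ.ψ_tgt, h]
    refine of_rep γ h (EdgePath.ext ?_ ?_ ?_) (EdgePath.ext ?_ ?_ ?_)
    · simp [EdgePath.whisker, h, e.idem]
    · simp [EdgePath.whisker, idem_mul_of_ψ_eq ht]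
    · refine (List.map_congr_left fun s hs' => ?_).trans (List.map_id _)
      simp [Step.whisker, Edge.whisker, (hs s hs').1]
    · simp [EdgePath.whisker, h, e.idem]
    · simp [EdgePath.whisker, mul_idem_of_ψ_eq ht]
    · refine (List.map_congr_left fun s hs' => ?_).trans (List.map_id _)
      simp [Step.whisker, Edge.whisker, (hs s hs').2]

/-- Whiskering acts step by step, so a path unchanged by whiskering with `e` has all its steps
unchanged. -/
theorem exists_ofPath (α : P.Bowtie e) : ∃ γ h hs, α = ofPath γ h hs := by
  obtain ⟨γ, h, h₁, h₂, h₃⟩ := α.exists_rep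
  refine ⟨γ, h₁, fun s hs => ⟨?_, ?_⟩, Bowtie.ext h⟩
  · have h₄ := congrArg EdgePath.steps h₂
    have := List.map_inj_left.1 (h₄.trans (List.map_id _).symm) s hs
    exact congrArg (fun s => s.1.p) this
  · have h₄ := congrArg EdgePath.steps h₃
    have := List.map_inj_left.1 (h₄.trans (List.map_id _).symm) s hs
    exact congrArg (fun s => s.1.q) this

end Bowtie

theorem steps_star_of_fixed {e : Idem P.T} (γ δ : P.EdgePath)
    (hs : γ.Fixed e) (h' : δ.src = e.val) :
    (γ.star δ).steps = γ.steps ++ δ.steps.map fun s => s.whisker γ.tgt 1 := by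
  change (γ.steps.map fun s => s.whisker 1 δ.src) ++ _ = _
  congr 1
  refine (List.map_congr_left fun s hs' => ?_).trans (List.map_id _)
  simp [Step.whisker, Edge.whisker, (hs s hs').2, h']

/-- The element `u⁻¹ l⁻¹ l u` is `e` for a triple `(l, r, u ψ)` in `Y_e`. -/
theorem src_generator {e : Idem M} (y : P.Y e) {u : P.T} (hu : P.ψ u = y.m) :
    u⁻¹ * P.ρτ y.l.inv * P.ρτ y.l * u = (P.lift e).val := by
  rw [ρτ_inv]
  have hi := idem_conj (idem_inv_mul (P.ρτ y.l)) u
  simp only [mul_assoc] at hi ⊢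
  -- Both sides are idempotent, so they may be compared in `M`, where the order condition on the
  -- triple says that `l⁻¹ l` fixes `m`.
  refine P.idem_eq (by simpa only [mul_assoc] using hi) (P.lift e).idem ?_
  have h := mul_eq_of_natLE (idem_ψ_inv_mul_rel y.rel) y.le
  rw [ψ_inv_mul_rel y.rel, ← hu] at h
  rw [P.ψ_lift, ← y.eq, ← hu]
  conv_rhs => rw [← h]
  simp only [map_mul, map_inv', mul_inv_rev', inv_inv', mul_assoc, inv_mul_cancel']

theorem inv_mul_of_ψ_eq {e : Idem M} (y : P.Y e) {u : P.T} (hu : P.ψ u = y.m) :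
    u⁻¹ * u = (P.lift e).val := by
  refine P.idem_eq (idem_inv_mul u) (P.lift e).idem ?_
  rw [P.ψ_lift, map_mul, map_inv', hu, y.eq]

/-- The class of `(u⁻¹ l⁻¹, l, r, u)` as an element of `star_e^⋈`. -/
noncomputable def generatorBowtie {e : Idem M} (y : P.Y e) (u : P.T) (hu : P.ψ u = y.m) :
    P.Bowtie (P.lift e) :=
  Bowtie.ofPath (EdgePath.single ⟨u⁻¹ * P.ρτ y.l.inv, y.l, y.r, u, y.rel⟩)
    (src_generator y hu) (by
      have h := inv_mul_of_ψ_eq y hu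
      simp only [EdgePath.Fixed, EdgePath.single, List.mem_singleton, forall_eq, ← h]
      rw [← mul_assoc, ← mul_assoc, inv_mul_inv, mul_inv_mul]
      exact ⟨rfl, rfl⟩)

theorem sabWeight_generator {e : Idem M} (y : P.Y e) (u : P.T) (hu : P.ψ u = y.m) :
    sabWeight e (P.bar (generatorBowtie y u hu)) = .of (y.l, y.r, y.m) := by
  rw [sabWeight_bar]
  have : y.m * e.val = y.m := by rw [← y.eq, ← mul_assoc, mul_inv_mul]
  simp [generatorBowtie, Bowtie.ofPath, Arrow.weight, Arrow.mk, EdgePath.weight, EdgePath.single,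
    Step.weight, hu, this]

theorem bar_mul {e : Idem M} (α β : P.Bowtie (P.lift e)) : P.bar (α * β) = P.bar α + P.bar β := by
  simp [bar]

theorem bar_one {e : Idem M} : P.bar (1 : P.Bowtie (P.lift e)) = 0 := by
  simp [bar]

/-- The class of a generator in the abelianisation depends on `u ψ` only. -/
theorem bar_generatorBowtie_eq {e : Idem M} (y : P.Y e) {u v : P.T} (hu : P.ψ u = y.m)
    (hv : P.ψ v = y.m) : P.bar (generatorBowtie y u hu) = P.bar (generatorBowtie y v hv) := by
  set f := P.lift e with hf
  have hu' := inv_mul_of_ψ_eq y hu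
  have huv : u * u⁻¹ = v * v⁻¹ := mul_inv_eq_of_ψ_eq (hu.trans hv.symm)
  have ht : P.ψ (u⁻¹ * v) = P.ψ f.val := by
    rw [map_mul, hv, ← hu, ← map_mul, hu']
  -- A path from `e` to `u⁻¹ v`; whiskering it by `e` on both sides keeps its end points and places
  -- it in `star_e^⋈`.
  obtain ⟨L, hL⟩ := exists_isPath ht.symm
  have hL' := hL.whisker f.val f.val
  rw [f.idem, f.idem, idem_mul_of_ψ_eq ht, mul_idem_of_ψ_eq ht] at hL'
  let δ : P.EdgePath := ⟨f.val, u⁻¹ * v, _, hL'⟩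
  have hδ : δ.Fixed f := by
    intro s hs
    obtain ⟨s, -, rfl⟩ := List.mem_map.1 hs
    simp only [Step.whisker, Edge.whisker]
    rw [← mul_assoc, mul_assoc s.1.q, f.idem]
    exact ⟨rfl, rfl⟩
  -- Moving the edge at `u` past `δ` multiplies its right coordinate to `u u⁻¹ v = v`, while in `δ ∗
  -- g_v` the left coordinate is `u⁻¹ v v⁻¹ l⁻¹ = u⁻¹ l⁻¹`: the same edge.
  have key : generatorBowtie y u hu * Bowtie.ofPath δ rfl hδ =
      Bowtie.ofPath δ rfl hδ * generatorBowtie y v hv := by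
    apply Bowtie.ext
    have hfv : u⁻¹ * v * v⁻¹ = u⁻¹ := by rw [mul_assoc, ← huv, ← mul_assoc, inv_mul_inv]
    have hfu : u * (u⁻¹ * v) = v := by rw [← mul_assoc, huv, mul_inv_mul]
    have hsu := src_generator y hu
    have hsv := src_generator y hv
    refine Quotient.sound (s := P.homotopySetoid) ?_
    refine equiv_swap ⟨u⁻¹ * P.ρτ y.l.inv, y.l, y.r, u, y.rel⟩ hL' [] _ _ ?_ ?_ ?_ ?_
    · change 1 * (u⁻¹ * P.ρτ y.l.inv * P.ρτ y.l * u) * f.val =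
        1 * f.val * (v⁻¹ * P.ρτ y.l.inv * P.ρτ y.l * v)
      rw [hsu, hsv]
    · change u⁻¹ * P.ρτ y.l.inv * P.ρτ y.r * u * (u⁻¹ * v) * 1 =
        u⁻¹ * v * (v⁻¹ * P.ρτ y.l.inv * P.ρτ y.r * v) * 1
      rw [mul_assoc _ u, hfu]
      simp only [← mul_assoc]
      rw [hfv]
    · rfl
    · change (δ.steps.map fun s => s.whisker 1 (v⁻¹ * P.ρτ y.l.inv * P.ρτ y.l * v)) ++
        [(⟨u⁻¹ * v * (v⁻¹ * P.ρτ y.l.inv), y.l, y.r, v * 1, y.rel⟩, true)] =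
        (δ.steps.map fun s => s.whisker (u⁻¹ * P.ρτ y.l.inv * P.ρτ y.l * u) 1) ++
        [(⟨1 * (u⁻¹ * P.ρτ y.l.inv), y.l, y.r, u * (u⁻¹ * v), y.rel⟩, true)]
      rw [hsu, hsv, ← hf, hfu, ← mul_assoc (u⁻¹ * v), hfv, one_mul, mul_one]
      congr 1
      refine List.map_congr_left fun s hs => ?_
      simp only [Step.whisker, Edge.whisker, one_mul, mul_one, (hδ s hs).1, (hδ s hs).2]
  have h := congrArg P.bar key
  rw [bar_mul, bar_mul, add_comm] at h
  exact add_left_cancel h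

end Presentation

namespace Presentation

variable {X M : Type*} [InverseMonoid M] {P : Presentation X M}

/-! ### Generation by the triples -/

namespace Bowtie

variable {e : Idem P.T}

theorem fixed_whisker {γ : P.EdgePath} (h : P.ψ γ.src = P.ψ e.val) (hs : γ.Fixed e) :
    (γ.whisker γ.src⁻¹ 1).Fixed e := by
  intro _ hw
  obtain ⟨s, hs', rfl⟩ := List.mem_map.1 hw
  have h' := inv_mul_eq_of_ψ_eq_idem h
  simp only [Step.whisker, Edge.whisker, mul_one]
  rw [← h', ← mul_assoc, inv_mul_inv, h']
  exact ⟨rfl, (hs s hs').2⟩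

/-- An edge path whose vertices have image `e ψ` in `M`, moved so as to start at `e`. -/
def shift (γ : P.EdgePath) (h : P.ψ γ.src = P.ψ e.val) (hs : γ.Fixed e) : P.Bowtie e :=
  ofPath (γ.whisker γ.src⁻¹ 1)
    (by simp [EdgePath.whisker, inv_mul_eq_of_ψ_eq_idem h]) (fixed_whisker h hs)

theorem shift_of_steps_eq_nil (γ : P.EdgePath) (h : P.ψ γ.src = P.ψ e.val) (hs : γ.Fixed e)
    (hn : γ.steps = []) : shift γ h hs = 1 := by
  apply Bowtie.ext
  have ht : γ.src = γ.tgt := by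
    have := γ.isPath
    rw [hn] at this
    exact this
  refine congrArg Arrow.mk (EdgePath.ext ?_ ?_ ?_)
  · simp [EdgePath.whisker, EdgePath.const, inv_mul_eq_of_ψ_eq_idem h]
  · simp [EdgePath.whisker, EdgePath.const, ← ht, inv_mul_eq_of_ψ_eq_idem h]
  · simp [EdgePath.whisker, EdgePath.const, hn]

/-- In the product, the translate of `δ` is whiskered by the end `γ.src⁻¹ δ.src` of the translate of
`γ`. Since `δ.src δ.src⁻¹ = e` is absorbed by `γ.src⁻¹`, the total translation of `δ` is by
`γ.src⁻¹`, as on the left-hand side. -/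
theorem shift_comp (γ δ : P.EdgePath) (hγδ : γ.tgt = δ.src) (h : P.ψ γ.src = P.ψ e.val)
    (hs : γ.Fixed e) (h' : P.ψ δ.src = P.ψ e.val) (hs' : δ.Fixed e)
    (hs'' : (γ.comp δ hγδ).Fixed e) :
    shift (γ.comp δ hγδ) h hs'' = shift γ h hs * shift δ h' hs' := by
  apply Bowtie.ext
  have hδ := inv_mul_eq_of_ψ_eq_idem h'
  have hγ : γ.src⁻¹ * e.val = γ.src⁻¹ := by
    rw [← mul_inv_eq_of_ψ_eq_idem h, ← mul_assoc, inv_mul_inv]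
  refine congrArg Arrow.mk (EdgePath.ext ?_ ?_ ?_)
  · simp [EdgePath.whisker, EdgePath.star, EdgePath.comp, hδ, inv_mul_eq_of_ψ_eq_idem h, e.idem]
  · simp only [EdgePath.whisker, EdgePath.star, EdgePath.comp, mul_one, hγδ]
    rw [mul_assoc, ← mul_assoc δ.src, mul_inv_eq_of_ψ_eq_idem h', ← mul_assoc, hγ]
  · rw [steps_star_of_fixed (e := e) _ _ (fixed_whisker h hs) (by simp [EdgePath.whisker, hδ])]
    simp only [EdgePath.whisker, EdgePath.comp, List.map_append, List.map_map]
    congr 1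
    refine List.map_congr_left fun s _ => ?_
    simp only [Function.comp, Step.whisker_whisker, mul_one]
    rw [mul_assoc, hγδ, mul_inv_eq_of_ψ_eq_idem h', hγ]

/-- By `shift_comp` the product of the two translates is the translate of a path contracting to a
constant one. This reduces backward steps to forward ones. -/
theorem shift_reverse (γ : P.EdgePath) (h : P.ψ γ.src = P.ψ e.val) (hs : γ.Fixed e)
    (h' : P.ψ γ.reverse.src = P.ψ e.val) (hs' : γ.reverse.Fixed e) :
    shift γ.reverse h' hs' = (shift γ h hs)⁻¹ := by
  have hc : (γ.reverse.comp γ rfl).Fixed e := by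
    intro s hs''
    rcases List.mem_append.1 hs'' with h₁ | h₁
    exacts [hs' s h₁, hs s h₁]
  rw [eq_inv_iff_mul_eq_one, ← shift_comp γ.reverse γ rfl h' hs' h hs hc,
    ← shift_of_steps_eq_nil (EdgePath.const γ.tgt) h' (by intro s hs; cases hs) rfl]
  apply Bowtie.ext
  refine Quotient.sound (s := P.homotopySetoid) (EdgePath.whisker_equiv ?_ _ _)
  exact EdgePath.steps_cancel γ.isPath _ _ rfl rfl rfl rfl

end Bowtie

/-- The subgroup of `(star_e^⋈)^ab` generated by the classes of `(u⁻¹ l⁻¹, l, r, u)`. -/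
noncomputable def generatorSubgroup (e : Idem M) : AddSubgroup (P.Sab e) :=
  AddSubgroup.closure {a | ∃ (y : P.Y e) (u : P.T) (hu : P.ψ u = y.m),
    a = P.bar (generatorBowtie y u hu)}

theorem bar_inv {e : Idem M} (α : P.Bowtie (P.lift e)) : P.bar α⁻¹ = -P.bar α := by
  simp [bar]

/-- Translation turns `(p, l, r, q)` into `((p l q)⁻¹ p, l, r, q)`, and `(p l q)⁻¹ p = q⁻¹ l⁻¹`; so
the result is the generator with `u = q`. -/
theorem bar_shift_single_mem {e : Idem M} (a : P.Edge)
    (h : P.ψ (EdgePath.single a).src = P.ψ (P.lift e).val)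
    (hs : (EdgePath.single a).Fixed (P.lift e)) :
    P.bar (Bowtie.shift (EdgePath.single a) h hs) ∈ generatorSubgroup e := by
  have ht := inv_mul_eq_of_ψ_eq_idem h
  obtain ⟨p, l, r, q, hr⟩ := a
  obtain ⟨-, hq⟩ : (P.lift e).val * p = p ∧ q * (P.lift e).val = q :=
    hs _ (List.mem_singleton_self _)
  change (p * P.ρτ l * q)⁻¹ * (p * P.ρτ l * q) = _ at ht
  have h₁ := inv_mul_eq_of_conj ht hq
  have h₂ := inv_mul_mul_eq_of_conj ht hq
  have h₃ := inv_mul_left_eq_of_conj ht hq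
  let y : P.Y e :=
    { l := l
      r := r
      m := P.ψ q
      rel := hr
      le := by
        refine ⟨P.ψ q * (P.ψ q)⁻¹, idem_mul_inv _, ?_⟩
        rw [ψ_inv_mul_rel hr, ← mul_assoc, ← map_mul, h₂]
      eq := by rw [← map_inv', ← map_mul, h₁, P.ψ_lift] }
  refine AddSubgroup.subset_closure ⟨y, q, rfl, congrArg P.bar (Bowtie.ext ?_)⟩
  refine congrArg Arrow.mk (EdgePath.ext ?_ ?_ ?_)
  · change (p * P.ρτ l * q)⁻¹ * (p * P.ρτ l * q) * 1 = q⁻¹ * P.ρτ l.inv * P.ρτ l * q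
    rw [mul_one, mul_assoc p, ← mul_assoc, ← mul_assoc p, h₃, ρτ_inv]
    simp only [mul_assoc]
  · change (p * P.ρτ l * q)⁻¹ * (p * P.ρτ r * q) * 1 = q⁻¹ * P.ρτ l.inv * P.ρτ r * q
    rw [mul_one, mul_assoc p (P.ρτ r), ← mul_assoc, h₃, ρτ_inv]
    simp only [mul_assoc]
  · change [((⟨(p * P.ρτ l * q)⁻¹ * p, l, r, q * 1, hr⟩ : P.Edge), true)] =
      [(⟨q⁻¹ * P.ρτ l.inv, l, r, q, hr⟩, true)]
    rw [h₃, ρτ_inv, mul_one]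

/-- Induction on the steps: each contributes a generator or, when run backwards, the negative of
one. Paths starting anywhere over `e ψ` are allowed because the tail no longer starts at `e`. -/
theorem bar_shift_mem {e : Idem M} (γ : P.EdgePath) (h : P.ψ γ.src = P.ψ (P.lift e).val)
    (hs : γ.Fixed (P.lift e)) : P.bar (Bowtie.shift γ h hs) ∈ generatorSubgroup e := by
  obtain ⟨a, b, L, hL⟩ := γ
  induction L generalizing a with
  | nil =>
    rw [Bowtie.shift_of_steps_eq_nil _ h hs rfl, bar_one]
    exact zero_mem _
  | cons s L ih =>
    obtain ⟨rfl, hL⟩ := hL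
    let σ : P.EdgePath := ⟨s.src, s.tgt, [s], rfl, rfl⟩
    have hσ : σ.Fixed (P.lift e) := fun s' h' => hs s' (by
      rw [List.mem_singleton.1 h']; exact List.mem_cons_self)
    have h' : P.ψ s.tgt = P.ψ (P.lift e).val := (EdgePath.ψ_tgt σ).trans h
    have hs' : EdgePath.Fixed (P.lift e) ⟨s.tgt, b, L, hL⟩ :=
      fun s' h' => hs s' (List.mem_cons_of_mem _ h')
    have key := Bowtie.shift_comp σ ⟨s.tgt, b, L, hL⟩ rfl h hσ h' hs' hs
    refine (congrArg (fun x => P.bar x ∈ generatorSubgroup e) key).mpr ?_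
    rw [bar_mul]
    refine add_mem ?_ (ih _ hL h' hs')
    obtain ⟨a, b⟩ := s
    cases b
    · have hr : (EdgePath.single a).Fixed (P.lift e) := fun s' h' => by
        rw [List.mem_singleton.1 h']; exact hs (a, false) List.mem_cons_self
      have := Bowtie.shift_reverse (EdgePath.single a) h' hr h hσ
      refine (congrArg (fun x => P.bar x ∈ generatorSubgroup e) this).mpr ?_
      rw [bar_inv]
      exact neg_mem (bar_shift_single_mem a _ _)
    · exact bar_shift_single_mem a h hσ

/-- A fixed path that starts at `e` is its own translate, since `e⁻¹ = e`. -/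
theorem mem_generatorSubgroup {e : Idem M} (x : P.Sab e) : x ∈ generatorSubgroup e := by
  obtain ⟨α, rfl⟩ : ∃ α, P.bar α = x := QuotientGroup.mk_surjective x.toMul
  obtain ⟨γ, h, hs, rfl⟩ := α.exists_ofPath
  have key : Bowtie.ofPath γ h hs = Bowtie.shift γ (by rw [h]) hs := by
    apply Bowtie.ext
    have : γ.whisker γ.src⁻¹ 1 = γ := by
      have ht : P.ψ γ.tgt = P.ψ (P.lift e).val := by rw [γ.ψ_tgt, h]
      rw [h, inv_of_idem (P.lift e).idem]
      refine EdgePath.ext ?_ ?_ ?_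
      · simp [EdgePath.whisker, h, (P.lift e).idem]
      · simp [EdgePath.whisker, idem_mul_of_ψ_eq ht]
      · refine (List.map_congr_left fun s hs' => ?_).trans (List.map_id _)
        simp [Step.whisker, Edge.whisker, (hs s hs').1]
    exact congrArg Arrow.mk this.symm
  rw [key]
  exact bar_shift_mem _ _ _

/-! ### The free abelian group on the triples -/

variable (P) in
/-- The triple of a basis element of the free Lausch module on `𝓩`. -/
def freeIndexEquiv (e : Idem M) : FreeIndex P.Z e ≃ P.Y e where
  toFun x := ⟨x.base.2.l, x.base.2.r, x.elt, x.base.2.rel, by rw [x.base.2.eq]; exact x.le, x.eq⟩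
  invFun y :=
    -- The idempotent indexing the component of `𝓩` is determined by the relation, so a triple need
    -- not record it.
    { base := ⟨⟨P.ψ (P.ρτ (y.l.inv * y.r)), idem_ψ_inv_mul_rel y.rel⟩, ⟨y.l, y.r, y.rel, rfl⟩⟩
      elt := y.m
      le := y.le
      eq := y.eq }
  left_inv x := by
    obtain ⟨⟨⟨f, hf⟩, ⟨l, r, hr, h⟩⟩, m, le, eq⟩ := x
    simp only at h
    subst h
    rfl
  right_inv y := rfl

/-- The class of `(u⁻¹ l⁻¹, l, r, u)` in the abelianisation, for any `u` with `u ψ = m`. -/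
noncomputable def generatorBar {e : Idem M} (y : P.Y e) : P.Sab e :=
  P.bar (generatorBowtie y (ψ_surjective P y.m).choose (ψ_surjective P y.m).choose_spec)

theorem generatorBar_eq {e : Idem M} (y : P.Y e) {u : P.T} (hu : P.ψ u = y.m) :
    generatorBar y = P.bar (generatorBowtie y u hu) :=
  bar_generatorBowtie_eq y _ hu

theorem sabWeight_generatorBar {e : Idem M} (y : P.Y e) :
    sabWeight e (generatorBar y) = .of (y.l, y.r, y.m) :=
  sabWeight_generator y _ _

/-- The composite is induced by the inclusion of `Y_e` in the set of all triples, so it is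
injective; this is the linear independence of the generators. -/
theorem sabWeight_comp_lift (e : Idem M) :
    (sabWeight e).comp (FreeAbelianGroup.lift (generatorBar (P := P) (e := e))) =
      FreeAbelianGroup.map fun y : P.Y e => (y.l, y.r, y.m) := by
  ext y
  simp [sabWeight_generatorBar, FreeAbelianGroup.map_of_apply]

theorem freeAbelianGroup_map_injective {α β : Type*} {f : α → β} (hf : Function.Injective f) :
    Function.Injective (FreeAbelianGroup.map f) := by
  intro a b h
  apply (FreeAbelianGroup.equivFinsupp α).injective
  apply Finsupp.mapDomain_injective hf
  have key : ∀ a, Finsupp.mapDomain f (FreeAbelianGroup.equivFinsupp α a) =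
      FreeAbelianGroup.equivFinsupp β (FreeAbelianGroup.map f a) := by
    intro a
    refine DFunLike.congr_fun (f := (Finsupp.mapDomain.addMonoidHom f).comp
      (FreeAbelianGroup.equivFinsupp α).toAddMonoidHom) (g :=
      (FreeAbelianGroup.equivFinsupp β).toAddMonoidHom.comp (FreeAbelianGroup.map f)) ?_ a
    ext x
    simp [FreeAbelianGroup.equivFinsupp, Finsupp.mapDomain_single]
  rw [key, key, h]

theorem map_triple_injective (e : Idem M) :
    Function.Injective (FreeAbelianGroup.map fun y : P.Y e => (y.l, y.r, y.m)) := by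
  apply freeAbelianGroup_map_injective
  rintro ⟨l, r, m, h₁, h₂, h₃⟩ ⟨l', r', m', h₁', h₂', h₃'⟩ h
  simp only [Prod.mk.injEq] at h
  obtain ⟨rfl, rfl, rfl⟩ := h
  rfl

variable (P) in
/-- `(star_e^⋈)^ab` is free abelian on the set of triples `Y_e`. -/
noncomputable def freeEquiv (e : Idem M) : FreeAbelianGroup (P.Y e) ≃+ P.Sab e :=
  AddEquiv.ofBijective (FreeAbelianGroup.lift generatorBar) <| by
    refine ⟨?_, fun x => ?_⟩
    · have h := map_triple_injective (P := P) e
      rw [← sabWeight_comp_lift, AddMonoidHom.coe_comp] at h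
      exact h.of_comp
    · have h : generatorSubgroup e ≤ (FreeAbelianGroup.lift (generatorBar (P := P))).range := by
        refine (AddSubgroup.closure_le _).2 ?_
        rintro _ ⟨y, u, hu, rfl⟩
        exact ⟨.of y, by rw [FreeAbelianGroup.lift_apply_of, generatorBar_eq y hu]⟩
      exact h (mem_generatorSubgroup x)

theorem freeEquiv_of {e : Idem M} (y : P.Y e) : freeEquiv P e (.of y) = generatorBar y :=
  FreeAbelianGroup.lift_apply_of generatorBar y

theorem sabWeight_freeEquiv {e : Idem M} (a : FreeAbelianGroup (P.Y e)) :
    sabWeight e (freeEquiv P e a) = FreeAbelianGroup.map (fun y => (y.l, y.r, y.m)) a :=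
  DFunLike.congr_fun (sabWeight_comp_lift e) a

/-- The generators span and have independent weights, so an equality in `(star_e^⋈)^ab` can be
tested on weights. -/
theorem sabWeight_injective (e : Idem M) : Function.Injective (sabWeight (P := P) e) := by
  intro x y h
  obtain ⟨a, rfl⟩ := (freeEquiv P e).surjective x
  obtain ⟨b, rfl⟩ := (freeEquiv P e).surjective y
  rw [sabWeight_freeEquiv, sabWeight_freeEquiv] at h
  rw [map_triple_injective e h]

variable (P) in
/-- The isomorphism at `e` from the free Lausch module on `𝓩`. -/
noncomputable def lauschEquiv (e : Idem M) :
    FreeAbelianGroup (FreeIndex P.Z e) ≃+ P.Sab e :=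
  (FreeAbelianGroup.equivOfEquiv (freeIndexEquiv P e)).trans (freeEquiv P e)

theorem lauschEquiv_of {e : Idem M} (x : FreeIndex P.Z e) :
    lauschEquiv P e (.of x) = generatorBar (freeIndexEquiv P e x) := by
  rw [← freeEquiv_of]
  refine congrArg (freeEquiv P e) (FreeAbelianGroup.map_of_apply _)

theorem sabWeight_lauschEquiv {e : Idem M} (a : FreeAbelianGroup (FreeIndex P.Z e)) :
    sabWeight e (lauschEquiv P e a) =
      FreeAbelianGroup.map (fun x => (x.base.2.l, x.base.2.r, x.elt)) a := by
  change sabWeight e (freeEquiv P e (FreeAbelianGroup.map _ a)) = _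
  rw [sabWeight_freeEquiv, ← FreeAbelianGroup.map_comp_apply]
  rfl

/-! ### The Lausch module structure and the basis -/

variable (P) in
/-- The Lausch module structure on the groups `(star_e^⋈)^ab`. -/
noncomputable def sabModule : LauschModule M P.Sab := (freeLausch P.Z).transport (lauschEquiv P)

/-- The element `w⁻¹ ▷ α ◁ w`. -/
def Bowtie.conj {e : Idem M} (α : P.Bowtie (P.lift e)) (w : P.T) :
    P.Bowtie (P.lift (e.conj (P.ψ w))) where
  val := α.val.whisker w⁻¹ w
  mem := by
    have hc : (P.lift (e.conj (P.ψ w))).val = w⁻¹ * (P.lift e).val * w := by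
      refine P.idem_eq (P.lift _).idem (idem_conj (P.lift e).idem w) ?_
      rw [P.ψ_lift, map_mul, map_mul, map_inv', P.ψ_lift]
      rfl
    obtain ⟨γ, h, h₁, h₂, h₃⟩ := α.exists_rep
    have hγ : γ = γ.whisker (P.lift e).val (P.lift e).val := by
      conv_lhs => rw [← h₃, ← h₂, EdgePath.whisker_whisker, one_mul]
    rw [h, hc]
    refine ⟨Arrow.mk (γ.whisker w⁻¹ w), ?_, congrArg Arrow.mk ?_⟩
    · change w⁻¹ * γ.src * w = _
      rw [h₁]
    · rw [hγ]
      simp only [EdgePath.whisker_whisker]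
      -- As `e` commutes with `w w⁻¹`, the idempotent `w⁻¹ e w` is absorbed by `w⁻¹ e` on the left
      -- and by `e w` on the right.
      have he := (P.lift e).idem
      congr 1
      · calc w⁻¹ * (P.lift e).val = (w⁻¹ * w * w⁻¹) * ((P.lift e).val * (P.lift e).val) := by
              rw [inv_mul_inv, he]
          _ = w⁻¹ * ((w * w⁻¹) * (P.lift e).val) * (P.lift e).val := by simp only [mul_assoc]
          _ = _ := by rw [idem_comm (idem_mul_inv w) he]; simp only [mul_assoc]
      · calc (P.lift e).val * w = (P.lift e).val * (P.lift e).val * (w * w⁻¹ * w) := by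
              rw [mul_inv_mul, he]
          _ = (P.lift e).val * ((P.lift e).val * (w * w⁻¹)) * w := by simp only [mul_assoc]
          _ = _ := by rw [idem_comm he (idem_mul_inv w)]; simp only [mul_assoc]

/-- Compare weights. The transported action multiplies third coordinates by `w ψ`, changing the
parameter `e` to `e (w ψ)`; conjugation by `w` gives the parameter `(w ψ) (w ψ)⁻¹ e (w ψ)`, which is
the same element. -/
theorem sabModule_act {e : Idem M} (α : P.Bowtie (P.lift e)) (w : P.T) :
    (sabModule P).act ⟨e, P.bar α⟩ (P.ψ w) = ⟨e.conj (P.ψ w), P.bar (α.conj w)⟩ := by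
  obtain ⟨a, ha⟩ := (lauschEquiv P e).surjective (P.bar α)
  refine Sigma.ext rfl (heq_of_eq (sabWeight_injective _ ?_))
  change sabWeight (e.conj (P.ψ w)) (lauschEquiv P _
    (FreeAbelianGroup.map (FreeIndex.smul (P.ψ w) rfl) ((lauschEquiv P e).symm (P.bar α)))) = sabWeight (e.conj (P.ψ w)) (P.bar (α.conj w))
  have h := sabWeight_bar α
  rw [← ha, sabWeight_lauschEquiv] at h
  rw [← ha, AddEquiv.symm_apply_apply, sabWeight_lauschEquiv, ← FreeAbelianGroup.map_comp_apply,
    sabWeight_bar]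
  have h' : (α.conj w).val.weight (e.conj (P.ψ w)).val = α.val.weight (e.val * P.ψ w) := by
    refine (Arrow.weight_whisker _ _ _ _).trans (congrArg (fun m => α.val.weight m) ?_)
    change P.ψ w * ((P.ψ w)⁻¹ * e.val * P.ψ w) = e.val * P.ψ w
    have := idem_conj_comm (c := P.ψ w) (one_mul 1) e.idem
    rwa [one_mul, mul_one] at this
  rw [h', ← Arrow.map_weight, ← h, ← FreeAbelianGroup.map_comp_apply]
  rfl

variable (P) in
/-- The basis of `(star_e^⋈)^ab` given by the triples in `Y_e`. -/
noncomputable def sabBasis (e : Idem M) : Module.Basis (P.Y e) ℤ (P.Sab e) :=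
  (FreeAbelianGroup.basis (P.Y e)).map (freeEquiv P e).toIntLinearEquiv

theorem sabBasis_apply {e : Idem M} (y : P.Y e) : sabBasis P e y = generatorBar y := by
  rw [← freeEquiv_of]
  have h : FreeAbelianGroup.basis (P.Y e) y = .of y :=
    Module.Basis.apply_eq_iff.2 (FreeAbelianGroup.toFinsupp_of y)
  exact congrArg (freeEquiv P e) h

end Presentation

end InverseMonoid

theorem mainTheorem8 {X : Type*} {M : Type*} [InverseMonoid M] (P : Presentation X M) :
    ∃ L : LauschModule M P.Sab,
      (∀ (e : Idem M) (α : P.Bowtie (P.lift e)) (w : P.T),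
        ∃ β : P.Bowtie (P.lift (e.conj (P.ψ w))),
          β.val = Presentation.Arrow.whisker w⁻¹ α.val w ∧
          L.act ⟨e, P.bar α⟩ (P.ψ w) = ⟨e.conj (P.ψ w), P.bar β⟩) ∧
      (∃ Φ : LauschIso (freeLausch P.Z) L,
        ∀ (e : Idem M) (x : FreeIndex P.Z e) (u : P.T), P.ψ u = x.elt →
          ∃ α : P.Bowtie (P.lift e),
            α.val = Presentation.generator x.base.2.rel u ∧
            Φ.equiv e (FreeAbelianGroup.of x) = P.bar α) ∧
      (∀ e : Idem M, ∃ b : Module.Basis (P.Y e) ℤ (P.Sab e),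
        ∀ (y : P.Y e) (u : P.T), P.ψ u = y.m →
          ∃ α : P.Bowtie (P.lift e),
            α.val = Presentation.generator y.rel u ∧ b y = P.bar α) := by
  refine ⟨Presentation.sabModule P, fun e α w => ⟨α.conj w, rfl, Presentation.sabModule_act α w⟩,
    ⟨(freeLausch P.Z).transportIso (Presentation.lauschEquiv P), fun e x u hu => ?_⟩,
    fun e => ⟨Presentation.sabBasis P e, fun y u hu => ?_⟩⟩
  · refine ⟨Presentation.generatorBowtie (Presentation.freeIndexEquiv P e x) u hu, rfl, ?_⟩
    exact (Presentation.lauschEquiv_of x).trans (Presentation.generatorBar_eq _ hu)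
  · exact ⟨Presentation.generatorBowtie y u hu, rfl,
      (Presentation.sabBasis_apply y).trans (Presentation.generatorBar_eq y hu)⟩
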